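/- Let $k$ be a field of characteristic $0$ and $m,n\ge 0$. All objects are $\mathbb Z\times\mathbb Z$-graded by bidegrees $|a|=(p(a),w(a))$ (parity, weight); put $|a||b|:=p(a)p(b)+w(a)w(b)$. $\mathrm{Sym}\{\dots\}$ is the free algebra on the listed generators with $ab=(-1)^{|a||b|}ba$. Let $\mathcal O(k^{m||n})=\mathrm{Sym}\{x_1,\dots,x_m,y_1,\dots,y_n\}$ with $|x_i|=(0,0)$, $|y_j|=(1,0)$, and $\mathcal O(k^{n\wedge m})=\mathrm{Sym}\{\xi_1,\dots,\xi_m,\eta_1,\dots,\eta_n\}$ with $|\xi_i|=(0,-1)$, $|\eta_j|=(-1,-1)$. Let $A=\mathrm{Sym}\{z_1,\dots,z_l\}$, $l=m+n$, be one of these two algebras. *Poisson cohomology.* The polyvectors are $\mathfrak X(A)=\mathrm{Sym}\{z_i,\partial_i\}$, $|\partial_i|=-|z_i|-(0,1)$. The Schouten–Nijenhuis bracket is the bilinear bracket of bidegree $(0,1)$ on $\mathfrak X(A)$ with $[\partial_i,z_j]=\delta_{ij}$, $[z_i,z_j]=[\partial_i,\partial_j]=0$, $[P,Q]=-(-1)^{(|P|+(0,1))(|Q|+(0,1))}[Q,P]$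 and $[P,QS]=[P,Q]S+(-1)^{|Q|(|P|+(0,1))}Q[P,S]$. A quadratic Poisson bivector is a linear combination $\pi$ of elements $z_az_b\,\partial_c\wedge\partial_d$, of bidegree $(0,-2)$, with $[\pi,\pi]=0$. Its Poisson cohomology is $\mathrm{HP}^{\bullet,\bullet}(A)=\ker\delta^\pi/\operatorname{im}\delta^\pi$ with $\delta^\pi=[-,\pi]$, where $\mathrm{HP}^{s,t}(A)$ consists of the classes of cocycles of bidegree $(-s,-t)$. *Unimodularity.* For each $i$ let $(u_i,v_i)=(z_i,\partial_i)$ if $p(z_i)+w(z_i)$ is even, and $(u_i,v_i)=(\partial_i,z_i)$ if it is odd. The mixed differential forms are $\tilde\Omega(A)=\mathrm{Sym}\{u_i,\tilde du_i\}$, $|\tilde du_i|=|u_i|+(0,1)$, with the derivation $\tilde d$ of bidegree $(0,1)$ determined by $u_i\mapsto\tilde du_i\mapsto0$. Mixed contraction $P\mapsto\tilde\iota_P$ is the linear map from $\mathfrak X(A)$ to the operators on $\tilde\Omega(A)$ with $\tilde\iota_{PQ}=\tilde\iota_P\tilde\iota_Q$ for which $\tilde\iota_{u_i}$ is multiplication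 by $u_i$, and $\tilde\iota_{v_i}$ is the derivation of bidegree $|v_i|$, $\tilde\iota_{v_i}(\alpha\beta)=\tilde\iota_{v_i}(\alpha)\beta+(-1)^{|\alpha||v_i|}\alpha\,\tilde\iota_{v_i}(\beta)$, that sends $\tilde du_i$ to the scalar $[v_i,u_i]=\pm1$ and all other generators to $0$. A mixed volume form is an element $\gamma\in\tilde\Omega(A)$ of bidegree $(-n,m)$ such that $P\mapsto\tilde\iota_P\gamma$ is a bijection $\mathfrak X(A)\to\tilde\Omega(A)$. The Poisson algebra $(A,\pi)$ is unimodular if $\partial_\pi\gamma=0$ for some mixed volume form $\gamma$, where $\partial_\pi=\tilde\iota_\pi\tilde d-\tilde d\,\tilde\iota_\pi$. **Corollary.** Let $A=(\mathcal O(k^{m||n}),\pi)$ and $A^!=(\mathcal O(k^{n\wedge m}),\pi^!)$ be unimodular quadratic Poisson algebras (for example Koszul dual ones; no relation between $\pi$ and $\pi^!$ is needed). Then $\mathrm{HP}^{\bullet,\bullet}(A)$ and $\mathrm{HP}^{\bullet,\bullet}(A^!)$ are Batalin–Vilkovisky algebras. That is, for each of the two: $(\delta^\pi)^2=0$; the product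 and the Schouten–Nijenhuis bracket descend to cohomology and make it a bigraded commutative associative unital algebra with a compatible graded Lie bracket of bidegree $(0,1)$ (a Gerstenhaber algebra); and there is a linear operator $\Delta$ of bidegree $(0,1)$ on the cohomology, i.e. $\Delta(\mathrm{HP}^{s,t})\subseteq\mathrm{HP}^{s,t-1}$, with $\Delta^2=0$, which is of second order, $$\begin{aligned}\Delta(abc)={}&\Delta(ab)c+(-1)^{w(a)}a\Delta(bc)+(-1)^{|b|(|a|+(0,1))}b\Delta(ac)\\&-\Delta(a)bc-(-1)^{w(a)}a\Delta(b)c-(-1)^{w(a)+w(b)}ab\Delta(c),\end{aligned}$$ and generates the induced bracket, $$[a,b]=(-1)^{w(a)}\Delta(ab)-(-1)^{w(a)}\Delta(a)b-a\Delta(b),$$ for all homogeneous $a,b,c$. -/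

import Mathlib

noncomputable section

namespace BigradedPoisson

/-! ### Bidegrees and the free bigraded commutative algebra -/

/-- The form `|x||y| = p(x)p(y) + w(x)w(y)` on bidegrees (parity, weight). -/
def dot (a b : ℤ × ℤ) : ℤ := a.1 * b.1 + a.2 * b.2

/-- The sign `(-1)^n` as a scalar. -/
def sgn (k : Type*) [Field k] (n : ℤ) : k := (-1 : k) ^ n

section Sym

variable {N : ℕ}

/-- Exponent vectors of the ordered monomials `g₀^{a₀} g₁^{a₁} ⋯` in generators of bidegrees `d`.
A generator which anticommutes with itself has square zero. -/
abbrev BiMon (d : Fin N → ℤ × ℤ) : Type :=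
  {a : Fin N → ℕ // ∀ g, Odd (dot (d g) (d g)) → a g ≤ 1}

/-- `Sym{g₀, …, g_{N-1}}`: the free bigraded commutative `k`-algebra, with
`x y = (-1)^{|x||y|} y x`, on generators of bidegrees `d`, in its basis of ordered monomials. -/
abbrev BiSym (k : Type*) [Field k] (d : Fin N → ℤ × ℤ) : Type _ := BiMon d →₀ k

variable (k : Type*) [Field k] (d : Fin N → ℤ × ℤ)

/-- Bidegree of a monomial. -/
def monDeg (a : BiMon d) : ℤ × ℤ := ∑ g, a.1 g • d g

/-- The homogeneous elements of bidegree `D`. -/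
def homog (D : ℤ × ℤ) : Submodule k (BiSym k d) :=
  Finsupp.supported k k {a | monDeg d a = D}

open Classical in
/-- Product of two ordered monomials; the sign comes from moving every generator of the second
monomial to the left past the later generators of the first. -/
def mulMon (a b : BiMon d) : BiSym k d :=
  if h : ∀ g, Odd (dot (d g) (d g)) → (a.1 + b.1) g ≤ 1 then
    Finsupp.single ⟨a.1 + b.1, h⟩
      (sgn k (∑ i, ∑ j ∈ Finset.Iio i, (a.1 i : ℤ) * (b.1 j : ℤ) * dot (d i) (d j)))
  else 0

/-- The (bilinear) product of `Sym`. -/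
def mul : BiSym k d →ₗ[k] BiSym k d →ₗ[k] BiSym k d :=
  Finsupp.linearCombination k fun a => Finsupp.linearCombination k fun b => mulMon k d a b

/-- The unit of `Sym`. -/
def one : BiSym k d := Finsupp.single ⟨0, fun _ _ => Nat.zero_le 1⟩ 1

/-- The generator `g` as an element of `Sym`. -/
def gen (g : Fin N) : BiSym k d :=
  Finsupp.single ⟨Pi.single g 1, fun h _ => by
    by_cases e : h = g
    · subst e; simp
    · simp [e]⟩ 1

/-- The monomial `a` with one factor `g` removed (if there is one). -/
def lowerMon (g : Fin N) (a : BiMon d) : BiMon d :=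
  ⟨fun h => a.1 h - (Pi.single g 1 : Fin N → ℕ) h,
    fun h ho => (Nat.sub_le _ _).trans (a.2 h ho)⟩

/-- Left partial derivative: the linear map with `g ↦ 1`, all other generators `↦ 0`, and
`L(ab) = L(a) b + (-1)^{|g||a|} a L(b)`. -/
def leftDeriv (g : Fin N) : BiSym k d →ₗ[k] BiSym k d :=
  Finsupp.linearCombination k fun a =>
    Finsupp.single (lowerMon d g a)
      ((a.1 g : k) * sgn k (∑ j ∈ Finset.Iio g, (a.1 j : ℤ) * dot (d g) (d j)))

/-- Right partial derivative: the linear map with `g ↦ 1`, all other generators `↦ 0`, and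
`R(ab) = a R(b) + (-1)^{|g||b|} R(a) b`. -/
def rightDeriv (g : Fin N) : BiSym k d →ₗ[k] BiSym k d :=
  Finsupp.linearCombination k fun a =>
    Finsupp.single (lowerMon d g a)
      ((a.1 g : k) * sgn k (∑ j ∈ Finset.Ioi g, (a.1 j : ℤ) * dot (d g) (d j)))

end Sym

/-- The cohomology `ker δ / im δ` of a differential `δ` (more precisely, `ker δ / (ker δ ∩ im δ)`). -/
abbrev Cohomology {k V : Type*} [Field k] [AddCommGroup V] [Module k V] (δ : V →ₗ[k] V) : Type _ :=
  LinearMap.ker δ ⧸ (LinearMap.range δ).submoduleOf (LinearMap.ker δ)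

/-- The class of a cocycle. -/
def Cohomology.mk {k V : Type*} [Field k] [AddCommGroup V] [Module k V] (δ : V →ₗ[k] V) :
    LinearMap.ker δ →ₗ[k] Cohomology δ := Submodule.mkQ _

/-! ### Polyvectors and the Schouten–Nijenhuis bracket

`e : Fin l → ℤ × ℤ` lists the bidegrees of the coordinates `z_i` of a bigraded space. -/

section Poly

variable {l : ℕ} (e : Fin l → ℤ × ℤ)

/-- Bidegrees of `z_0, …, z_{l-1}, ∂_0, …, ∂_{l-1}`, where `|∂_i| = -|z_i| - (0,1)`. -/
def polyDeg : Fin (l + l) → ℤ × ℤ := Fin.append e fun i => -e i - (0, 1)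

/-- The position of `z_i` (of `u_i` in mixed forms) among the generators. -/
def fstG (i : Fin l) : Fin (l + l) := Fin.castAdd l i

/-- The position of `∂_i` (of `d̃ u_i` in mixed forms) among the generators. -/
def sndG (i : Fin l) : Fin (l + l) := Fin.natAdd l i

/-- The algebra `𝔛(A) = Sym{z_i, ∂_i}` of polyvectors on `A = Sym{z_i}`. -/
abbrev Polyvector (k : Type*) [Field k] : Type _ := BiSym k (polyDeg e)

variable (k : Type*) [Field k]

/-- The value of `[z_i, ∂_i] = -(-1)^{(|z_i|+(0,1))·|z_i|} [∂_i, z_i] = -(-1)^{p(z_i)}`, where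
`[∂_i, z_i] = 1`. -/
def conjSign (i : Fin l) : k := -sgn k (e i).1

/-- The Schouten–Nijenhuis bracket: the biderivation of bidegree `(0,1)`, with
`[P, QS] = [P,Q] S + (-1)^{|Q|(|P|+(0,1))} Q [P,S]` and
`[P,Q] = -(-1)^{(|P|+(0,1))(|Q|+(0,1))} [Q,P]`, whose only non-zero values on generators are
`[∂_i, z_i] = 1` and hence `[z_i, ∂_i] = conjSign i`. -/
def schouten : Polyvector e k →ₗ[k] Polyvector e k →ₗ[k] Polyvector e k :=
  ∑ i, ((mul k (polyDeg e)).compl₁₂ (rightDeriv k (polyDeg e) (sndG i))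
          (leftDeriv k (polyDeg e) (fstG i))
      + conjSign e k i • (mul k (polyDeg e)).compl₁₂ (rightDeriv k (polyDeg e) (fstG i))
          (leftDeriv k (polyDeg e) (sndG i)))

/-- The monomial `z_{i₁} z_{i₂} ∂_{j₁} ∧ ∂_{j₂}`. -/
def quadMon (i₁ i₂ j₁ j₂ : Fin l) : Polyvector e k :=
  let m := mul k (polyDeg e)
  let g := gen k (polyDeg e)
  m (m (m (g (fstG i₁)) (g (fstG i₂))) (g (sndG j₁))) (g (sndG j₂))

variable {k}

/-- `π` is a quadratic Poisson bivector: a linear combination of the `z z ∂ ∧ ∂`, of bidegree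
`(0,-2)` (so that only the types `xx∂ₓ∂ₓ`, `yy∂_y∂_y`, `xy∂ₓ∂_y` occur), with `[π,π] = 0`. -/
structure IsQuadraticPoisson (π : Polyvector e k) : Prop where
  quadratic : π ∈ Submodule.span k
    {P | ∃ i₁ i₂ j₁ j₂ : Fin l, P = quadMon e k i₁ i₂ j₁ j₂}
  bidegree : π ∈ homog k (polyDeg e) (0, -2)
  poisson : schouten e k π π = 0

/-! ### Mixed differential forms and unimodularity -/

/-- `z_i` is even, i.e. commutes with itself. -/
def IsEvenCoord (i : Fin l) : Prop := Even ((e i).1 + (e i).2)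

open Classical in
/-- Bidegree of the `i`-th generator `u_i` of mixed `0`-forms: `u_i = z_i` if `z_i` is even and
`u_i = ∂_i` if `z_i` is odd. -/
def baseDeg (i : Fin l) : ℤ × ℤ := if IsEvenCoord e i then e i else -e i - (0, 1)

/-- Bidegrees of `u_0, …, u_{l-1}, d̃u_0, …, d̃u_{l-1}`. -/
def mixedDeg : Fin (l + l) → ℤ × ℤ := Fin.append (baseDeg e) fun i => baseDeg e i + (0, 1)

/-- The algebra `Sym{u_i, d̃u_i}` of mixed differential forms; `d̃u_i` is `dz_i` if `z_i` is even
and `z_i^*` if `z_i` is odd. -/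
abbrev MixedForm (k : Type*) [Field k] : Type _ := BiSym k (mixedDeg e)

variable (k)

/-- The differential `d̃`: the derivation of bidegree `(0,1)` with `u_i ↦ d̃u_i ↦ 0`. -/
def mixedD : Module.End k (MixedForm e k) :=
  ∑ i, mul k (mixedDeg e) (gen k (mixedDeg e) (sndG i)) ∘ₗ leftDeriv k (mixedDeg e) (fstG i)

open Classical in
/-- Mixed contraction by a generator of the polyvectors. The generator `u_i` acts by multiplication,
and its conjugate `v_i` by the derivation that sends `d̃u_i` to `[v_i, u_i]` and all other
generators to `0`. -/
def contractGen : Fin (l + l) → Module.End k (MixedForm e k) :=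
  Fin.append
    (fun i => if IsEvenCoord e i then mul k (mixedDeg e) (gen k (mixedDeg e) (fstG i))
      else conjSign e k i • leftDeriv k (mixedDeg e) (sndG i))
    (fun i => if IsEvenCoord e i then leftDeriv k (mixedDeg e) (sndG i)
      else mul k (mixedDeg e) (gen k (mixedDeg e) (fstG i)))

/-- Mixed contraction `P ↦ ι̃_P`, with `ι̃_{P ∧ Q} = ι̃_P ∘ ι̃_Q`. -/
def contract : Polyvector e k →ₗ[k] Module.End k (MixedForm e k) :=
  Finsupp.linearCombination k fun a => (List.ofFn fun g => contractGen e k g ^ a.1 g).prod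

variable {k}

/-- `∂_π = [ι̃_π, d̃] = ι̃_π ∘ d̃ - d̃ ∘ ι̃_π`, for `π` of bidegree `(0,-2)`. -/
def mixedBoundary (π : Polyvector e k) : Module.End k (MixedForm e k) :=
  contract e k π ∘ₗ mixedD e k - mixedD e k ∘ₗ contract e k π

/-- `γ` is a mixed volume form of bidegree `D`: contraction of polyvectors into `γ` is an
isomorphism onto mixed forms. -/
def IsMixedVolumeForm (D : ℤ × ℤ) (γ : MixedForm e k) : Prop :=
  γ ∈ homog k (mixedDeg e) D ∧ Function.Bijective fun P : Polyvector e k => contract e k P γ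

/-- `π` is unimodular: some mixed volume form is a Poisson cycle. -/
def IsUnimodular (D : ℤ × ℤ) (π : Polyvector e k) : Prop :=
  ∃ γ : MixedForm e k, IsMixedVolumeForm e D γ ∧ mixedBoundary e π γ = 0

/-! ### Poisson cohomology -/

/-- The Poisson coboundary `δ^π = [-, π]`. -/
def coboundary (π : Polyvector e k) : Polyvector e k →ₗ[k] Polyvector e k :=
  (schouten e k).flip π

/-- Poisson cohomology `HP(A) = ker δ^π / im δ^π`. -/
abbrev HP (π : Polyvector e k) : Type _ := Cohomology (coboundary e π)

/-- `HP^{s,t}(A)`: the classes of the cocycles of bidegree `(-s,-t)`. -/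
def HP.piece (π : Polyvector e k) (s t : ℤ) : Submodule k (HP e π) :=
  ((homog k (polyDeg e) (-s, -t)).comap (LinearMap.ker (coboundary e π)).subtype).map
    (Cohomology.mk (coboundary e π))

end Poly

/-! ### Batalin–Vilkovisky algebras -/

/-- `(H, mul, br, Δ)` with bigrading `H = ⨁ H^{s,t}` is a bigraded Batalin–Vilkovisky algebra: a
bigraded commutative algebra with a Gerstenhaber bracket generated by a second order operator `Δ`
with `Δ² = 0`. An element of `H^{s,t}` has bidegree `(-s,-t)`; `br` and `Δ` have bidegree `(0,1)`. -/
structure IsBVAlgebra {k H : Type*} [Field k] [AddCommGroup H] [Module k H]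
    (gr : ℤ → ℤ → Submodule k H) (one : H) (mul br : H →ₗ[k] H →ₗ[k] H) (Δ : H →ₗ[k] H) :
    Prop where
  isInternal : DirectSum.IsInternal fun D : ℤ × ℤ => gr D.1 D.2
  one_mem : one ∈ gr 0 0
  mul_mem : ∀ {s t s' t' : ℤ} {a b : H}, a ∈ gr s t → b ∈ gr s' t' →
    mul a b ∈ gr (s + s') (t + t')
  one_mul : ∀ a, mul one a = a
  mul_assoc : ∀ a b c, mul (mul a b) c = mul a (mul b c)
  mul_comm : ∀ {s t s' t' : ℤ} {a b : H}, a ∈ gr s t → b ∈ gr s' t' →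
    mul a b = sgn k (s * s' + t * t') • mul b a
  br_mem : ∀ {s t s' t' : ℤ} {a b : H}, a ∈ gr s t → b ∈ gr s' t' →
    br a b ∈ gr (s + s') (t + t' - 1)
  br_skew : ∀ {s t s' t' : ℤ} {a b : H}, a ∈ gr s t → b ∈ gr s' t' →
    br a b = -(sgn k (s * s' + (t - 1) * (t' - 1)) • br b a)
  br_jacobi : ∀ {s t s' t' s'' t'' : ℤ} {a b c : H},
    a ∈ gr s t → b ∈ gr s' t' → c ∈ gr s'' t'' →
    sgn k (s * s'' + (t - 1) * (t'' - 1)) • br (br a b) c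
      + sgn k (s * s' + (t - 1) * (t' - 1)) • br (br b c) a
      + sgn k (s' * s'' + (t' - 1) * (t'' - 1)) • br (br c a) b = 0
  br_mul : ∀ {s t s' t' : ℤ} {a b : H} (c : H), a ∈ gr s t → b ∈ gr s' t' →
    br a (mul b c) = mul (br a b) c + sgn k (s * s' + (t - 1) * t') • mul b (br a c)
  delta_mem : ∀ {s t : ℤ} {a : H}, a ∈ gr s t → Δ a ∈ gr s (t - 1)
  delta_sq : ∀ a, Δ (Δ a) = 0
  delta_second_order : ∀ {s t s' t' : ℤ} {a b : H} (c : H), a ∈ gr s t → b ∈ gr s' t' →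
    Δ (mul (mul a b) c) = mul (Δ (mul a b)) c + sgn k t • mul a (Δ (mul b c))
      + sgn k (s * s' + (t + 1) * t') • mul b (Δ (mul a c))
      - mul (mul (Δ a) b) c - sgn k t • mul (mul a (Δ b)) c
      - sgn k (t + t') • mul (mul a b) (Δ c)
  br_eq : ∀ {s t : ℤ} {a : H} (b : H), a ∈ gr s t →
    br a b = sgn k t • Δ (mul a b) - sgn k t • mul (Δ a) b - mul a (Δ b)

/-- `HP(A)` is a Batalin–Vilkovisky algebra: `δ^π` is a differential, the exterior product and the
Schouten–Nijenhuis bracket descend to `HP(A)`, and some operator `Δ` makes `HP(A)`, with these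
induced operations, a bigraded Batalin–Vilkovisky algebra. -/
def HPIsBV {k : Type*} [Field k] {l : ℕ} (e : Fin l → ℤ × ℤ) (π : Polyvector e k) : Prop :=
  LinearMap.range (coboundary e π) ≤ LinearMap.ker (coboundary e π) ∧
  ∃ (unit : HP e π) (prod br : HP e π →ₗ[k] HP e π →ₗ[k] HP e π) (Δ : HP e π →ₗ[k] HP e π),
    (∃ h : one k (polyDeg e) ∈ LinearMap.ker (coboundary e π),
      unit = Cohomology.mk (coboundary e π) ⟨_, h⟩) ∧
    (∀ P Q : LinearMap.ker (coboundary e π),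
      ∃ h : mul k (polyDeg e) P.1 Q.1 ∈ LinearMap.ker (coboundary e π),
        prod (Cohomology.mk _ P) (Cohomology.mk _ Q) = Cohomology.mk (coboundary e π) ⟨_, h⟩) ∧
    (∀ P Q : LinearMap.ker (coboundary e π),
      ∃ h : schouten e k P.1 Q.1 ∈ LinearMap.ker (coboundary e π),
        br (Cohomology.mk _ P) (Cohomology.mk _ Q) = Cohomology.mk (coboundary e π) ⟨_, h⟩) ∧
    IsBVAlgebra (HP.piece e π) unit prod br Δ

/-! ### The two bigraded spaces -/

/-- Bidegrees of the coordinates `x_1, …, x_m, y_1, …, y_n` of `k^{m||n}`. -/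
def degA (m n : ℕ) : Fin (m + n) → ℤ × ℤ := Fin.append (fun _ => (0, 0)) fun _ => (1, 0)

/-- Bidegrees of the coordinates `ξ_1, …, ξ_m, η_1, …, η_n` of `k^{n∧m}`. -/
def degDual (m n : ℕ) : Fin (m + n) → ℤ × ℤ := Fin.append (fun _ => (0, -1)) fun _ => (-1, -1)

end BigradedPoisson

end

/-! A mixed volume form `γ` identifies polyvectors with mixed forms, and this carries the
differential `d̃` to the divergence operator `Δ` on polyvectors, determined by `ι̃_{Δ P} γ = -d̃
(ι̃_P γ)`. The argument shows that `Δ` generates the Schouten bracket and that it survives the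
passage to Poisson cohomology.

The Schouten bracket is the derived bracket of `d̃`: up to sign, `[[d̃, ι̃_a], ι̃_b] = ι̃_{[a,b]}`
(`mixedD_commutator`). The reason is that `d̃ = ∑ d̃u_i ∂/∂u_i` while, modulo graded commutation,
`∂/∂u_i` acts on contractions as `∂/∂u_i` on polyvectors and multiplication by `d̃u_i` acts as a
multiple of `∂/∂v_i`. So `d̃` behaves as the second order operator `∑ ± ∂²/∂v_i∂u_i`, whose cross
terms form the bracket. Applied to `γ` with `d̃γ = 0`, the identity says that `Δ` generates the
bracket, and `d̃² = 0` gives `Δ² = 0`. Together with the Leibniz rule, all other axioms of a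
Batalin–Vilkovisky algebra follow formally (`IsBVGenerator.isBVAlgebra`).

Closedness of `γ` is forced by its bidegree `(-n, m)`. In both spaces only the `m` anticommuting
`d̃u_i` of bidegree `(0,1)` have positive weight, and each occurs at most once, so no mixed form has
weight `m + 1` (`homog_mixedDeg_eq_bot`).

Once `γ` is closed, unimodularity reduces to `d̃ ι̃_π γ = 0`, that is `Δ π = 0`. Then `Δ` commutes
with `δ^π = [-, π]`. Since `δ^π` is a derivation of the product and of the bracket and squares to
zero, every operation descends to its cohomology (`IsBVAlgebra.cohomology`). -/

noncomputable section

namespace BigradedPoisson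

/-! ### Signs -/

section Signs

variable (k : Type*) [Field k]

theorem sgn_add (m n : ℤ) : sgn k (m + n) = sgn k m * sgn k n :=
  zpow_add₀ (neg_ne_zero.2 one_ne_zero) m n

theorem sgn_eq_one_or (n : ℤ) : sgn k n = 1 ∨ sgn k n = -1 := by
  rcases Int.even_or_odd n with h | h
  · exact Or.inl h.neg_one_zpow
  · exact Or.inr h.neg_one_zpow

theorem sgn_neg (n : ℤ) : sgn k (-n) = sgn k n := by
  rcases Int.even_or_odd n with h | h
  · rw [sgn, sgn, h.neg.neg_one_zpow, h.neg_one_zpow]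
  · rw [sgn, sgn, h.neg.neg_one_zpow, h.neg_one_zpow]

theorem sgn_sub (m n : ℤ) : sgn k (m - n) = sgn k m * sgn k n := by
  rw [sub_eq_add_neg, sgn_add, sgn_neg]

@[simp] theorem sgn_zero : sgn k 0 = 1 := zpow_zero _

@[simp] theorem sgn_one : sgn k 1 = -1 := zpow_one _

theorem sgn_two : sgn k 2 = 1 := (even_two : Even (2 : ℤ)).neg_one_zpow

theorem sgn_mul_self (n : ℤ) : sgn k n * sgn k n = 1 := by
  rcases sgn_eq_one_or k n with h | h <;> simp [h]

theorem sgn_of_even {n : ℤ} (h : Even n) : sgn k n = 1 := h.neg_one_zpow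

theorem sgn_of_odd {n : ℤ} (h : Odd n) : sgn k n = -1 := h.neg_one_zpow

end Signs

/-! ### Algebras generated by a square-zero operator -/

section Generated

variable {k H : Type*} [Field k] [AddCommGroup H] [Module k H]
  {gr : ℤ → ℤ → Submodule k H} {one : H} {mul br : H →ₗ[k] H →ₗ[k] H} {Δ : H →ₗ[k] H}

/-- The data from which a Batalin–Vilkovisky algebra is generated: a bigraded commutative algebra
with a square-zero operator such that the bracket generated by it satisfies the Leibniz rule. -/
structure IsBVGenerator (gr : ℤ → ℤ → Submodule k H) (one : H) (mul br : H →ₗ[k] H →ₗ[k] H)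
    (Δ : H →ₗ[k] H) : Prop where
  isInternal : DirectSum.IsInternal fun D : ℤ × ℤ => gr D.1 D.2
  one_mem : one ∈ gr 0 0
  mul_mem : ∀ {s t s' t' : ℤ} {a b : H}, a ∈ gr s t → b ∈ gr s' t' →
    mul a b ∈ gr (s + s') (t + t')
  one_mul : ∀ a, mul one a = a
  mul_assoc : ∀ a b c, mul (mul a b) c = mul a (mul b c)
  mul_comm : ∀ {s t s' t' : ℤ} {a b : H}, a ∈ gr s t → b ∈ gr s' t' →
    mul a b = sgn k (s * s' + t * t') • mul b a
  br_mul : ∀ {s t s' t' : ℤ} {a b : H} (c : H), a ∈ gr s t → b ∈ gr s' t' →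
    br a (mul b c) = mul (br a b) c + sgn k (s * s' + (t - 1) * t') • mul b (br a c)
  delta_mem : ∀ {s t : ℤ} {a : H}, a ∈ gr s t → Δ a ∈ gr s (t - 1)
  delta_sq : ∀ a, Δ (Δ a) = 0
  br_eq : ∀ {s t : ℤ} {a : H} (b : H), a ∈ gr s t →
    br a b = sgn k t • Δ (mul a b) - sgn k t • mul (Δ a) b - mul a (Δ b)

namespace IsBVGenerator

variable (h : IsBVGenerator gr one mul br Δ)
include h

theorem br_mem {s t s' t' : ℤ} {a b : H} (ha : a ∈ gr s t) (hb : b ∈ gr s' t') :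
    br a b ∈ gr (s + s') (t + t' - 1) := by
  rw [h.br_eq b ha]
  refine sub_mem (sub_mem (Submodule.smul_mem _ _ (h.delta_mem (h.mul_mem ha hb)))
    (Submodule.smul_mem _ _ ?_)) ?_
  · have := h.mul_mem (h.delta_mem ha) hb
    rwa [show t - 1 + t' = t + t' - 1 by ring] at this
  · have := h.mul_mem ha (h.delta_mem hb)
    rwa [show t + (t' - 1) = t + t' - 1 by ring] at this

/-- The formula generating the bracket involves only `Δ` and the product, so exchanging the two
factors by graded commutativity changes it by a sign. -/
theorem br_skew {s t s' t' : ℤ} {a b : H} (ha : a ∈ gr s t) (hb : b ∈ gr s' t') :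
    br a b = -(sgn k (s * s' + (t - 1) * (t' - 1)) • br b a) := by
  rw [h.br_eq b ha, h.br_eq a hb, h.mul_comm ha hb, h.mul_comm (h.delta_mem ha) hb,
    h.mul_comm ha (h.delta_mem hb)]
  simp only [mul_sub, sub_mul, mul_one, _root_.one_mul, sgn_add, sgn_sub, sgn_one, map_smul]
  rcases sgn_eq_one_or k (s * s') with h1 | h1 <;> rcases sgn_eq_one_or k (t * t') with h2 | h2 <;>
  rcases sgn_eq_one_or k t with h3 | h3 <;> rcases sgn_eq_one_or k t' with h4 | h4 <;>
  simp only [h1, h2, h3, h4] <;> module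

/-- This uses only `Δ² = 0`: after expanding the brackets, the terms `Δ(Δ(ab))` disappear, the two
occurrences of `Δ(a) Δ(b)` cancel, and the rest agrees. -/
theorem delta_br {s t : ℤ} {a : H} (ha : a ∈ gr s t) (b : H) :
    Δ (br a b) = br (Δ a) b - sgn k t • br a (Δ b) := by
  rw [h.br_eq b ha, h.br_eq b (h.delta_mem ha), h.br_eq (Δ b) ha]
  simp only [sgn_sub, sgn_one, map_sub, map_smul, h.delta_sq, LinearMap.zero_apply, map_zero]
  rcases sgn_eq_one_or k t with h3 | h3 <;> simp only [h3] <;> module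

/-- Once each bracket is expressed through `Δ`, this is the Leibniz rule for `[a, bc]`, up to an
overall sign. -/
theorem delta_second_order {s t s' t' : ℤ} {a b : H} (c : H) (ha : a ∈ gr s t)
    (hb : b ∈ gr s' t') :
    Δ (mul (mul a b) c) = mul (Δ (mul a b)) c + sgn k t • mul a (Δ (mul b c))
      + sgn k (s * s' + (t + 1) * t') • mul b (Δ (mul a c))
      - mul (mul (Δ a) b) c - sgn k t • mul (mul a (Δ b)) c
      - sgn k (t + t') • mul (mul a b) (Δ c) := by
  have e := h.br_mul c ha hb
  rw [h.br_eq _ ha, h.br_eq _ ha, h.br_eq _ ha] at e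
  have e1 : mul b (mul a (Δ c)) = sgn k (s' * s + t' * t) • mul a (mul b (Δ c)) := by
    rw [← h.mul_assoc, h.mul_comm hb ha, map_smul, LinearMap.smul_apply, h.mul_assoc]
  have e2 : mul b (mul (Δ a) c) = sgn k (s' * s + t' * (t - 1)) • mul (Δ a) (mul b c) := by
    rw [← h.mul_assoc, h.mul_comm hb (h.delta_mem ha), map_smul, LinearMap.smul_apply, h.mul_assoc]
  simp only [map_sub, map_smul, LinearMap.sub_apply, LinearMap.smul_apply, e1, e2,
    h.mul_assoc] at e ⊢
  simp only [_root_.mul_comm s' s, _root_.mul_comm t' t, mul_sub, sub_mul, add_mul, mul_one, _root_.one_mul,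
    sgn_add, sgn_sub] at e ⊢
  rcases sgn_eq_one_or k (s * s') with h1 | h1 <;> rcases sgn_eq_one_or k (t * t') with h2 | h2 <;>
  rcases sgn_eq_one_or k t with h3 | h3 <;> rcases sgn_eq_one_or k t' with h4 | h4 <;>
  simp only [h1, h2, h3, h4] at e ⊢ <;>
  first | linear_combination (norm := module) e | linear_combination (norm := module) -e

/-- The Jacobi identity in Leibniz form. -/
theorem br_br {s t s' t' : ℤ} {a b : H} (c : H) (ha : a ∈ gr s t) (hb : b ∈ gr s' t') :
    br a (br b c) = br (br a b) c + sgn k (s * s' + (t - 1) * (t' - 1)) • br b (br a c) := by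
  -- The bracket `[b,c]` measures the failure of `Δ` to be a derivation of the product. Computing
  -- `Δ[a, bc]` with `Δ` a derivation of the bracket, and expanding by the Leibniz rule, therefore
  -- yields the action of `[a, -]` on `[b,c]`.
  have e1 := h.delta_br ha (mul b c)
  have ea := h.delta_mem ha
  have eb := h.delta_mem hb
  rw [h.br_mul c ha hb, h.br_mul c ea hb] at e1
  rw [h.br_eq c hb, h.br_eq c (h.br_mem ha hb), h.br_eq _ hb, h.delta_br ha, h.delta_br ha]
  simp only [map_sub, map_add, map_smul, LinearMap.sub_apply,
    LinearMap.smul_apply, h.br_mul c ha eb, h.br_mul (Δ c) ha hb] at e1 ⊢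
  simp only [mul_sub, sub_mul, mul_one, _root_.one_mul,
    sgn_add, sgn_sub, sgn_one] at e1 ⊢
  rcases sgn_eq_one_or k (s * s') with h1 | h1 <;> rcases sgn_eq_one_or k (t * t') with h2 | h2 <;>
  rcases sgn_eq_one_or k t with h3 | h3 <;> rcases sgn_eq_one_or k t' with h4 | h4 <;>
  simp only [h1, h2, h3, h4] at e1 ⊢ <;>
  first | linear_combination (norm := module) e1 | linear_combination (norm := module) -e1

theorem br_jacobi {s t s' t' s'' t'' : ℤ} {a b c : H} (ha : a ∈ gr s t) (hb : b ∈ gr s' t')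
    (hc : c ∈ gr s'' t'') :
    sgn k (s * s'' + (t - 1) * (t'' - 1)) • br (br a b) c
      + sgn k (s * s' + (t - 1) * (t' - 1)) • br (br b c) a
      + sgn k (s' * s'' + (t' - 1) * (t'' - 1)) • br (br c a) b = 0 := by
  have e := h.br_br c ha hb
  rw [h.br_skew (h.br_mem hb hc) ha, h.br_skew (h.br_mem hc ha) hb, h.br_skew hc ha, e,
    show (s' + s'') * s + (t' + t'' - 1 - 1) * (t - 1) =
      (s * s' + (t - 1) * (t' - 1)) + (s * s'' + (t - 1) * (t'' - 1)) by ring,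
    show (s'' + s) * s' + (t'' + t - 1 - 1) * (t' - 1) =
      (s * s' + (t - 1) * (t' - 1)) + (s' * s'' + (t' - 1) * (t'' - 1)) by ring,
    show s'' * s + (t'' - 1) * (t - 1) = s * s'' + (t - 1) * (t'' - 1) by ring]
  simp only [map_neg, map_smul, sgn_add k (_ + _) (_ + _)]
  rcases sgn_eq_one_or k (s * s' + (t - 1) * (t' - 1)) with h1 | h1 <;>
  rcases sgn_eq_one_or k (s * s'' + (t - 1) * (t'' - 1)) with h2 | h2 <;>
  rcases sgn_eq_one_or k (s' * s'' + (t' - 1) * (t'' - 1)) with h3 | h3 <;>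
  simp only [h1, h2, h3] <;> module

theorem isBVAlgebra : IsBVAlgebra gr one mul br Δ where
  isInternal := h.isInternal
  one_mem := h.one_mem
  mul_mem := h.mul_mem
  one_mul := h.one_mul
  mul_assoc := h.mul_assoc
  mul_comm := h.mul_comm
  br_mem := h.br_mem
  br_skew := h.br_skew
  br_jacobi := h.br_jacobi
  br_mul := h.br_mul
  delta_mem := h.delta_mem
  delta_sq := h.delta_sq
  delta_second_order := h.delta_second_order
  br_eq := h.br_eq

end IsBVGenerator

end Generated

/-! ### Cohomology of graded differentials -/

section CohomologyLemmas

variable {k V : Type*} [Field k] [AddCommGroup V] [Module k V] {δ : V →ₗ[k] V}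

theorem Cohomology.mk_surjective : Function.Surjective (Cohomology.mk δ) :=
  Submodule.mkQ_surjective _

theorem Cohomology.mk_eq_mk {P Q : LinearMap.ker δ} (h : P.1 - Q.1 ∈ LinearMap.range δ) :
    Cohomology.mk δ P = Cohomology.mk δ Q :=
  (Submodule.Quotient.eq _).2 h

/-- A linear map which preserves cocycles and coboundaries descends to cohomology. -/
theorem Cohomology.exists_map (f : V →ₗ[k] V)
    (hker : ∀ P ∈ LinearMap.ker δ, f P ∈ LinearMap.ker δ)
    (hrange : ∀ P ∈ LinearMap.range δ, f P ∈ LinearMap.range δ) :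
    ∃ F : Cohomology δ →ₗ[k] Cohomology δ, ∀ P : LinearMap.ker δ,
      F (Cohomology.mk δ P) = Cohomology.mk δ ⟨f P.1, hker _ P.2⟩ :=
  ⟨Submodule.mapQ _ _ (f.restrict hker) fun P hP => hrange P.1 hP, fun _ => rfl⟩

/-- A bilinear map compatible with cocycles and coboundaries descends to cohomology. -/
theorem Cohomology.exists_map₂ (B : V →ₗ[k] V →ₗ[k] V)
    (hker : ∀ P ∈ LinearMap.ker δ, ∀ Q ∈ LinearMap.ker δ, B P Q ∈ LinearMap.ker δ)
    (hleft : ∀ P ∈ LinearMap.range δ, ∀ Q ∈ LinearMap.ker δ, B P Q ∈ LinearMap.range δ)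
    (hright : ∀ P ∈ LinearMap.ker δ, ∀ Q ∈ LinearMap.range δ, B P Q ∈ LinearMap.range δ) :
    ∃ F : Cohomology δ →ₗ[k] Cohomology δ →ₗ[k] Cohomology δ, ∀ P Q : LinearMap.ker δ,
      F (Cohomology.mk δ P) (Cohomology.mk δ Q) =
        Cohomology.mk δ ⟨B P.1 Q.1, hker _ P.2 _ Q.2⟩ := by
  -- A linear section chooses representatives, which makes bilinearity immediate. Compatibility with
  -- coboundaries then shows that the value does not depend on this choice.
  obtain ⟨σ, hσ⟩ := (Cohomology.mk δ).exists_rightInverse_of_surjective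
    (LinearMap.range_eq_top.2 Cohomology.mk_surjective)
  have hσ' (x) : Cohomology.mk δ (σ x) = x := LinearMap.congr_fun hσ x
  refine ⟨LinearMap.mk₂ k
    (fun x y => Cohomology.mk δ ⟨B (σ x).1 (σ y).1, hker _ (σ x).2 _ (σ y).2⟩) ?_ ?_ ?_ ?_, ?_⟩
  · intro x x' y
    rw [← map_add]
    exact congrArg _ (Subtype.ext (by simp))
  · intro c x y
    rw [← map_smul]
    exact congrArg _ (Subtype.ext (by simp))
  · intro x y y'
    rw [← map_add]
    exact congrArg _ (Subtype.ext (by simp))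
  · intro c x y
    rw [← map_smul]
    exact congrArg _ (Subtype.ext (by simp))
  · intro P Q
    have hP := (Submodule.Quotient.eq _).1 (hσ' (Cohomology.mk δ P))
    have hQ := (Submodule.Quotient.eq _).1 (hσ' (Cohomology.mk δ Q))
    refine Cohomology.mk_eq_mk ?_
    have e : B (σ (Cohomology.mk δ P)).1 (σ (Cohomology.mk δ Q)).1 - B P.1 Q.1 =
        B ((σ (Cohomology.mk δ P)).1 - P.1) (σ (Cohomology.mk δ Q)).1 +
        B P.1 ((σ (Cohomology.mk δ Q)).1 - Q.1) := by
      simp only [map_sub, LinearMap.sub_apply]; abel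
    change B (σ (Cohomology.mk δ P)).1 (σ (Cohomology.mk δ Q)).1 - B P.1 Q.1 ∈ _
    rw [e]
    exact add_mem (hleft _ hP _ (σ _).2) (hright _ P.2 _ hQ)

variable {ι : Type*} [DecidableEq ι] (ℳ : ι → Submodule k V) [DirectSum.Decomposition ℳ]

/-- The projection to a homogeneous component. -/
def homogProj (i : ι) : V →ₗ[k] V :=
  (ℳ i).subtype ∘ₗ DirectSum.component k ι _ i ∘ₗ (DirectSum.decomposeLinearEquiv ℳ).toLinearMap

theorem homogProj_mem (i : ι) (x : V) : homogProj ℳ i x ∈ ℳ i := SetLike.coe_mem _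

theorem homogProj_of_mem {i : ι} {x : V} (hx : x ∈ ℳ i) : homogProj ℳ i x = x :=
  DirectSum.decompose_of_mem_same ℳ hx

theorem homogProj_of_mem_ne {i j : ι} {x : V} (hx : x ∈ ℳ i) (h : i ≠ j) :
    homogProj ℳ j x = 0 :=
  DirectSum.decompose_of_mem_ne ℳ hx h

variable {ℳ} {r : ι → ι} (hr : Function.Injective r) (hδ : ∀ i, ∀ x ∈ ℳ i, δ x ∈ ℳ (r i))
include hr hδ

theorem homogProj_comm (i : ι) (x : V) : homogProj ℳ (r i) (δ x) = δ (homogProj ℳ i x) := by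
  induction x using DirectSum.Decomposition.inductionOn ℳ with
  | zero => simp
  | add x y hx hy => simp only [map_add, hx, hy]
  | @homogeneous j x =>
    by_cases h : j = i
    · subst h
      rw [homogProj_of_mem ℳ x.2, homogProj_of_mem ℳ (hδ _ _ x.2)]
    · rw [homogProj_of_mem_ne ℳ x.2 h, homogProj_of_mem_ne ℳ (hδ _ _ x.2) (hr.ne h), map_zero]

theorem homogProj_mem_ker (i : ι) {x : V} (hx : x ∈ LinearMap.ker δ) :
    homogProj ℳ i x ∈ LinearMap.ker δ := by
  rw [LinearMap.mem_ker, ← homogProj_comm hr hδ, LinearMap.mem_ker.1 hx, map_zero]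

/-- The kernel of a homogeneous map is graded: each homogeneous component of a cocycle is again a
cocycle. -/
theorem ker_induction {p : V → Prop} (homogeneous : ∀ i, ∀ x ∈ ℳ i, δ x = 0 → p x)
    (zero : p 0) (add : ∀ x y, p x → p y → p (x + y)) : ∀ x ∈ LinearMap.ker δ, p x := by
  classical
  intro x hx
  rw [← DirectSum.sum_support_decompose ℳ x]
  refine Finset.sum_induction _ p add zero fun i _ => ?_
  exact homogeneous i _ (homogProj_mem ℳ i x) (homogProj_mem_ker hr hδ i hx)

/-- The homogeneous projections descend to cohomology. The `i`-th one is the identity on the `i`-th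
piece and kills the others, which gives independence. Surjectivity of the degree shift `r` ensures
that each component of a coboundary is the coboundary of a component. -/
theorem Cohomology.isInternal (hrr : ∀ i, ∃ j, r j = i) :
    DirectSum.IsInternal fun i =>
      ((ℳ i).comap (LinearMap.ker δ).subtype).map (Cohomology.mk δ) := by
  have hP : ∀ i, ∃ F : Cohomology δ →ₗ[k] Cohomology δ, ∀ P : LinearMap.ker δ,
      F (Cohomology.mk δ P) =
        Cohomology.mk δ ⟨homogProj ℳ i P.1, homogProj_mem_ker hr hδ i P.2⟩ := by
    intro i
    refine Cohomology.exists_map _ (fun P hP => homogProj_mem_ker hr hδ i hP) ?_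
    rintro _ ⟨x, rfl⟩
    obtain ⟨j, rfl⟩ := hrr i
    exact ⟨_, (homogProj_comm hr hδ j x).symm⟩
  choose F hF using hP
  rw [DirectSum.isInternal_submodule_iff_iSupIndep_and_iSup_eq_top]
  constructor
  · intro i
    rw [Submodule.disjoint_def]
    rintro _ ⟨P, hP, rfl⟩ h2
    have h3 : (⨆ j, ⨆ (_ : j ≠ i),
        ((ℳ j).comap (LinearMap.ker δ).subtype).map (Cohomology.mk δ)) ≤ LinearMap.ker (F i) := by
      refine iSup₂_le fun j hj => ?_
      rintro _ ⟨Q, hQ, rfl⟩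
      rw [LinearMap.mem_ker, hF, ← map_zero (Cohomology.mk δ)]
      exact congrArg _ (Subtype.ext (homogProj_of_mem_ne ℳ hQ hj))
    rw [← LinearMap.mem_ker.1 (h3 h2), hF]
    exact congrArg _ (Subtype.ext (homogProj_of_mem ℳ hP).symm)
  · rw [eq_top_iff]
    rintro x -
    obtain ⟨⟨P, hP⟩, rfl⟩ := Cohomology.mk_surjective x
    have key : ∀ P ∈ LinearMap.ker δ, ∃ hP : P ∈ LinearMap.ker δ, Cohomology.mk δ ⟨P, hP⟩ ∈
        ⨆ i, ((ℳ i).comap (LinearMap.ker δ).subtype).map (Cohomology.mk δ) := by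
      refine ker_induction hr hδ (fun i P hP h0 => ⟨h0, ?_⟩) ⟨zero_mem _, ?_⟩ ?_
      · exact Submodule.mem_iSup_of_mem i (Submodule.mem_map_of_mem hP)
      · exact zero_mem _
      · rintro P Q ⟨hP, h1⟩ ⟨hQ, h2⟩
        exact ⟨add_mem hP hQ, add_mem h1 h2⟩
    exact (key P hP).2

end CohomologyLemmas

/-! ### Twisting a Batalin–Vilkovisky algebra by a Maurer–Cartan element -/

section Twist

variable {k H : Type*} [Field k] [AddCommGroup H] [Module k H]
  {gr : ℤ → ℤ → Submodule k H} {one : H} {mul br : H →ₗ[k] H →ₗ[k] H} {Δ : H →ₗ[k] H} {π : H}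

namespace IsBVAlgebra

variable (h : IsBVAlgebra gr one mul br Δ) (hπ : π ∈ gr 0 2)
include h

/-- The second order identity at `1, 1, 1` reads `Δ(1) = 3Δ(1) - 3Δ(1)`. -/
theorem delta_one : Δ one = 0 := by
  have e := h.delta_second_order one h.one_mem h.one_mem
  have e1 : mul (Δ one) one = Δ one := by
    rw [h.mul_comm (h.delta_mem h.one_mem) h.one_mem, h.one_mul]; simp
  simp only [h.one_mul, e1] at e
  simp only [mul_zero, add_zero, zero_add, sgn_zero, one_smul] at e
  linear_combination (norm := module) e

include hπ

theorem br_mem_of_mem {s t : ℤ} {a : H} (ha : a ∈ gr s t) : br a π ∈ gr s (t + 1) := by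
  have := h.br_mem ha hπ
  rwa [add_zero, show t + 2 - 1 = t + 1 by ring] at this

theorem br_mul_right {s t s' t' : ℤ} {a b : H} (ha : a ∈ gr s t) (hb : b ∈ gr s' t') :
    br (mul a b) π = sgn k t' • mul (br a π) b + mul a (br b π) := by
  have e := h.br_mul b hπ ha
  rw [h.br_skew (h.mul_mem ha hb) hπ, h.br_skew ha hπ, h.br_skew hb hπ, e]
  simp only [map_smul, map_neg, LinearMap.neg_apply, LinearMap.smul_apply]
  simp only [mul_zero, zero_mul, zero_add, show (2 : ℤ) - 1 = 1 by norm_num, mul_one,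
    _root_.one_mul, sgn_sub, sgn_add, sgn_one]
  rcases sgn_eq_one_or k t with h3 | h3 <;> rcases sgn_eq_one_or k t' with h4 | h4 <;>
  simp only [h3, h4] <;> module

/-- The Jacobi identity with third entry `π`, rearranged so that `[-, π]` appears as a graded
derivation of the bracket. -/
theorem br_br_right {s t s' t' : ℤ} {a b : H} (ha : a ∈ gr s t) (hb : b ∈ gr s' t') :
    br (br a b) π = br a (br b π) - sgn k t' • br (br a π) b := by
  have e := h.br_jacobi ha hb hπ
  rw [h.br_skew (h.br_mem_of_mem hπ hb) ha, h.br_skew hπ ha] at e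
  simp only [map_smul, map_neg, LinearMap.neg_apply, LinearMap.smul_apply] at e
  simp only [mul_zero, zero_mul, zero_add, show (2 : ℤ) - 1 = 1 by norm_num, mul_one,
    add_sub_cancel_right, mul_sub, sub_mul, _root_.mul_comm s' s, _root_.mul_comm t' t,
    _root_.one_mul, sgn_sub, sgn_add, sgn_one] at e
  rcases sgn_eq_one_or k (s * s') with h1 | h1 <;> rcases sgn_eq_one_or k (t * t') with h2 | h2 <;>
  rcases sgn_eq_one_or k t with h3 | h3 <;> rcases sgn_eq_one_or k t' with h4 | h4 <;>
  simp only [h1, h2, h3, h4] at e ⊢ <;>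
  first | linear_combination (norm := module) e | linear_combination (norm := module) -e

-- The assumption `Δ π = 0` removes the term `a Δ(π)` from `[a, π]`. Applying `Δ` to what remains
-- gives `[Δ a, π]`, because `Δ² = 0`.
omit hπ in
theorem delta_br {s t : ℤ} {a : H} (hΔ : Δ π = 0) (ha : a ∈ gr s t) :
    Δ (br a π) = br (Δ a) π := by
  rw [h.br_eq π ha, h.br_eq π (h.delta_mem ha), hΔ]
  simp only [map_sub, map_smul, h.delta_sq, sgn_sub, sgn_one, map_zero, LinearMap.zero_apply]
  module

/-- The derivation rule for `[[a,π],π]` returns `[a,[π,π]]` minus the same term, so `[π,π] = 0`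
gives only `2[[a,π],π] = 0`; characteristic zero finishes the argument. -/
theorem br_br_self [CharZero k] {s t : ℤ} {a : H} (hππ : br π π = 0) (ha : a ∈ gr s t) :
    br (br a π) π = 0 := by
  have e := h.br_br_right hπ ha hπ
  rw [hππ, map_zero, sgn_two, one_smul] at e
  have e2 : (2 : k) • br (br a π) π = 0 := by linear_combination (norm := module) e
  exact (smul_eq_zero.1 e2).resolve_left two_ne_zero

/-- A Maurer–Cartan element `π` with `Δ π = 0` makes the cohomology of `[-, π]` a
Batalin–Vilkovisky algebra. -/
theorem cohomology [CharZero k] (hππ : br π π = 0) (hΔ : Δ π = 0) :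
    LinearMap.range (br.flip π) ≤ LinearMap.ker (br.flip π) ∧
    ∃ (unit : Cohomology (br.flip π))
      (prod br' : Cohomology (br.flip π) →ₗ[k] Cohomology (br.flip π) →ₗ[k] Cohomology (br.flip π))
      (Δ' : Cohomology (br.flip π) →ₗ[k] Cohomology (br.flip π)),
      (∃ h : one ∈ LinearMap.ker (br.flip π), unit = Cohomology.mk (br.flip π) ⟨_, h⟩) ∧
      (∀ P Q : LinearMap.ker (br.flip π), ∃ h : mul P.1 Q.1 ∈ LinearMap.ker (br.flip π),
        prod (Cohomology.mk _ P) (Cohomology.mk _ Q) = Cohomology.mk (br.flip π) ⟨_, h⟩) ∧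
      (∀ P Q : LinearMap.ker (br.flip π), ∃ h : br P.1 Q.1 ∈ LinearMap.ker (br.flip π),
        br' (Cohomology.mk _ P) (Cohomology.mk _ Q) = Cohomology.mk (br.flip π) ⟨_, h⟩) ∧
      IsBVAlgebra (fun s t => ((gr s t).comap (LinearMap.ker (br.flip π)).subtype).map
        (Cohomology.mk (br.flip π))) unit prod br' Δ' := by
  classical
  let _ := h.isInternal.chooseDecomposition
  set δ := br.flip π with hδdef
  have hδ (x) : δ x = br x π := rfl
  have hr : Function.Injective fun D : ℤ × ℤ => (D.1, D.2 + 1) := by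
    rintro ⟨a, b⟩ ⟨c, d⟩ e
    simpa using e
  have hδr : ∀ D : ℤ × ℤ, ∀ x ∈ gr D.1 D.2, δ x ∈ gr D.1 (D.2 + 1) :=
    fun D x hx => h.br_mem_of_mem hπ hx
  have kerInd {p : H → Prop} (hom : ∀ s t, ∀ x ∈ gr s t, br x π = 0 → p x) (zero : p 0)
      (add : ∀ x y, p x → p y → p (x + y)) : ∀ x ∈ LinearMap.ker δ, p x :=
    ker_induction (ℳ := fun D : ℤ × ℤ => gr D.1 D.2) hr hδr (fun D => hom D.1 D.2) zero add
  have ind {p : H → Prop} (hom : ∀ s t, ∀ x ∈ gr s t, p x) (zero : p 0)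
      (add : ∀ x y, p x → p y → p (x + y)) : ∀ x, p x := fun x =>
    DirectSum.Decomposition.inductionOn (fun D : ℤ × ℤ => gr D.1 D.2) zero
      (fun {D} x => hom D.1 D.2 x.1 x.2) add x
  have rangeInd {p : H → Prop} (hom : ∀ s t, ∀ x ∈ gr s t, p (br x π)) (zero : p 0)
      (add : ∀ x y, p x → p y → p (x + y)) : ∀ x ∈ LinearMap.range δ, p x := by
    rintro _ ⟨x, rfl⟩
    refine ind (p := fun x => p (δ x)) hom (by simpa using zero) (fun x y hx hy => ?_) x
    rw [map_add]; exact add _ _ hx hy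
  have hsq : LinearMap.range δ ≤ LinearMap.ker δ :=
    rangeInd (fun s t x hx => h.br_br_self hπ hππ hx) (zero_mem _) (fun _ _ => add_mem)
  -- In `[1,π] = Δ(π) - Δ(1) π - Δ(π)` every term vanishes.
  have hunit : one ∈ LinearMap.ker δ := by
    rw [LinearMap.mem_ker, hδ, h.br_eq π h.one_mem, h.delta_one, h.one_mul, hΔ]
    simp
  obtain ⟨prod, hprod⟩ := Cohomology.exists_map₂ (δ := δ) mul
    (by
      intro P hP Q hQ
      revert P
      refine kerInd (fun s t a ha h0 => ?_) (by simp)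
        (fun x y hx hy => by rw [map_add]; exact add_mem hx hy)
      revert Q
      refine kerInd (fun s' t' b hb h1 => ?_) (by simp)
        (fun x y hx hy => by rw [map_add]; exact add_mem hx hy)
      rw [LinearMap.mem_ker, hδ, h.br_mul_right hπ ha hb, h0, h1]
      simp)
    (by
      intro P hP Q hQ
      revert P
      refine rangeInd (fun s t a ha => ?_) (by simp)
        (fun x y hx hy => by rw [map_add]; exact add_mem hx hy)
      revert Q
      refine kerInd (fun s' t' b hb h1 => ?_) (by simp)
        (fun x y hx hy => by rw [map_add]; exact add_mem hx hy)
      refine ⟨sgn k t' • mul a b, ?_⟩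
      rw [map_smul, hδ, h.br_mul_right hπ ha hb, h1, map_zero, add_zero, smul_smul, sgn_mul_self,
        one_smul])
    (by
      intro P hP Q hQ
      revert P
      refine kerInd (fun s t a ha h0 => ?_) (by simp)
        (fun x y hx hy => by rw [map_add]; exact add_mem hx hy)
      revert Q
      refine rangeInd (fun s' t' b hb => ?_) (by simp)
        (fun x y hx hy => by rw [map_add]; exact add_mem hx hy)
      refine ⟨mul a b, ?_⟩
      rw [hδ, h.br_mul_right hπ ha hb, h0]
      simp)
  obtain ⟨br', hbr⟩ := Cohomology.exists_map₂ (δ := δ) br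
    (by
      intro P hP Q hQ
      revert P
      refine kerInd (fun s t a ha h0 => ?_) (by simp)
        (fun x y hx hy => by rw [map_add]; exact add_mem hx hy)
      revert Q
      refine kerInd (fun s' t' b hb h1 => ?_) (by simp)
        (fun x y hx hy => by rw [map_add]; exact add_mem hx hy)
      rw [LinearMap.mem_ker, hδ, h.br_br_right hπ ha hb, h0, h1]
      simp)
    (by
      intro P hP Q hQ
      revert P
      refine rangeInd (fun s t a ha => ?_) (by simp)
        (fun x y hx hy => by rw [map_add]; exact add_mem hx hy)
      revert Q
      refine kerInd (fun s' t' b hb h1 => ?_) (by simp)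
        (fun x y hx hy => by rw [map_add]; exact add_mem hx hy)
      refine ⟨-(sgn k t' • br a b), ?_⟩
      rw [map_neg, map_smul, hδ, h.br_br_right hπ ha hb, h1, map_zero, zero_sub, smul_neg, neg_neg,
        smul_smul, sgn_mul_self, one_smul])
    (by
      intro P hP Q hQ
      revert P
      refine kerInd (fun s t a ha h0 => ?_) (by simp)
        (fun x y hx hy => by rw [map_add]; exact add_mem hx hy)
      revert Q
      refine rangeInd (fun s' t' b hb => ?_) (by simp)
        (fun x y hx hy => by rw [map_add]; exact add_mem hx hy)
      refine ⟨br a b, ?_⟩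
      rw [hδ, h.br_br_right hπ ha hb, h0]
      simp)
  have hcomm : ∀ x, Δ (δ x) = δ (Δ x) :=
    ind (fun s t x hx => h.delta_br hΔ hx) (by simp)
      (fun x y hx hy => by simp only [map_add, hx, hy])
  obtain ⟨Δ', hΔ'⟩ := Cohomology.exists_map (δ := δ) Δ
    (fun P hP => by rw [LinearMap.mem_ker, ← hcomm, LinearMap.mem_ker.1 hP, map_zero])
    (by rintro _ ⟨x, rfl⟩; exact ⟨_, (hcomm x).symm⟩)
  refine ⟨hsq, Cohomology.mk δ ⟨one, hunit⟩, prod, br', Δ', ⟨hunit, rfl⟩, fun P Q => ⟨_, hprod P Q⟩,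
    fun P Q => ⟨_, hbr P Q⟩, ?_⟩
  -- Apart from the decomposition into pieces, each axiom already holds for representing cocycles
  -- and passes to their classes.
  constructor
  · exact Cohomology.isInternal (ℳ := fun D : ℤ × ℤ => gr D.1 D.2) hr hδr
      fun D => ⟨(D.1, D.2 - 1), by simp⟩
  · exact ⟨_, h.one_mem, rfl⟩
  · rintro s t s' t' _ _ ⟨P, hP, rfl⟩ ⟨Q, hQ, rfl⟩
    rw [hprod]
    exact ⟨_, h.mul_mem hP hQ, rfl⟩
  · intro a
    obtain ⟨P, rfl⟩ := Cohomology.mk_surjective a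
    rw [hprod]
    exact congrArg _ (Subtype.ext (h.one_mul _))
  · intro a b c
    obtain ⟨P, rfl⟩ := Cohomology.mk_surjective a
    obtain ⟨Q, rfl⟩ := Cohomology.mk_surjective b
    obtain ⟨R, rfl⟩ := Cohomology.mk_surjective c
    simp only [hprod]
    exact congrArg _ (Subtype.ext (h.mul_assoc _ _ _))
  · rintro s t s' t' _ _ ⟨P, hP, rfl⟩ ⟨Q, hQ, rfl⟩
    simp only [hprod, ← map_smul]
    exact congrArg _ (Subtype.ext (h.mul_comm hP hQ))
  · rintro s t s' t' _ _ ⟨P, hP, rfl⟩ ⟨Q, hQ, rfl⟩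
    rw [hbr]
    exact ⟨_, h.br_mem hP hQ, rfl⟩
  · rintro s t s' t' _ _ ⟨P, hP, rfl⟩ ⟨Q, hQ, rfl⟩
    simp only [hbr, ← map_smul, ← map_neg]
    exact congrArg _ (Subtype.ext (h.br_skew hP hQ))
  · rintro s t s' t' s'' t'' _ _ _ ⟨P, hP, rfl⟩ ⟨Q, hQ, rfl⟩ ⟨R, hR, rfl⟩
    simp only [hbr, ← map_smul, ← map_add]
    rw [← map_zero (Cohomology.mk δ)]
    exact congrArg _ (Subtype.ext (h.br_jacobi hP hQ hR))
  · rintro s t s' t' _ _ c ⟨P, hP, rfl⟩ ⟨Q, hQ, rfl⟩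
    obtain ⟨R, rfl⟩ := Cohomology.mk_surjective c
    simp only [hprod, hbr, ← map_smul, ← map_add]
    exact congrArg _ (Subtype.ext (h.br_mul R.1 hP hQ))
  · rintro s t _ ⟨P, hP, rfl⟩
    rw [hΔ']
    exact ⟨_, h.delta_mem hP, rfl⟩
  · intro a
    obtain ⟨P, rfl⟩ := Cohomology.mk_surjective a
    simp only [hΔ']
    rw [← map_zero (Cohomology.mk δ)]
    exact congrArg _ (Subtype.ext (h.delta_sq _))
  · rintro s t s' t' _ _ c ⟨P, hP, rfl⟩ ⟨Q, hQ, rfl⟩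
    obtain ⟨R, rfl⟩ := Cohomology.mk_surjective c
    simp only [hprod, hΔ', ← map_smul, ← map_add, ← map_sub]
    exact congrArg _ (Subtype.ext (h.delta_second_order R.1 hP hQ))
  · rintro s t _ b ⟨P, hP, rfl⟩
    obtain ⟨Q, rfl⟩ := Cohomology.mk_surjective b
    simp only [hprod, hbr, hΔ', ← map_smul, ← map_sub]
    exact congrArg _ (Subtype.ext (h.br_eq Q.1 hP))

end IsBVAlgebra

end Twist

/-! ### The free bigraded commutative algebra -/

section Dot

theorem dot_add_left (a b c : ℤ × ℤ) : dot (a + b) c = dot a c + dot b c := by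
  simp only [dot, Prod.fst_add, Prod.snd_add]; ring

theorem dot_add_right (a b c : ℤ × ℤ) : dot a (b + c) = dot a b + dot a c := by
  simp only [dot, Prod.fst_add, Prod.snd_add]; ring

theorem dot_comm (a b : ℤ × ℤ) : dot a b = dot b a := by
  simp only [dot]; ring

theorem dot_neg_left (a b : ℤ × ℤ) : dot (-a) b = -dot a b := by
  simp only [dot, Prod.fst_neg, Prod.snd_neg]; ring

theorem dot_neg_right (a b : ℤ × ℤ) : dot a (-b) = -dot a b := by
  simp only [dot, Prod.fst_neg, Prod.snd_neg]; ring

theorem dot_sub_left (a b c : ℤ × ℤ) : dot (a - b) c = dot a c - dot b c := by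
  simp only [dot, Prod.fst_sub, Prod.snd_sub]; ring

theorem dot_sub_right (a b c : ℤ × ℤ) : dot a (b - c) = dot a b - dot a c := by
  simp only [dot, Prod.fst_sub, Prod.snd_sub]; ring

@[simp] theorem dot_zero_right (a : ℤ × ℤ) : dot a 0 = 0 := by simp [dot]

@[simp] theorem dot_zero_left (a : ℤ × ℤ) : dot 0 a = 0 := by simp [dot]

theorem dot_nsmul_right (a b : ℤ × ℤ) (n : ℕ) : dot a (n • b) = n * dot a b := by
  simp only [dot, Prod.smul_fst, Prod.smul_snd]; simp only [nsmul_eq_mul]; ring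

theorem dot_sum_right {ι : Type*} (s : Finset ι) (a : ℤ × ℤ) (f : ι → ℤ × ℤ) :
    dot a (∑ i ∈ s, f i) = ∑ i ∈ s, dot a (f i) := by
  classical
  induction s using Finset.induction_on with
  | empty => simp
  | insert i s hi ih => rw [Finset.sum_insert hi, Finset.sum_insert hi, dot_add_right, ih]

end Dot

/-! ### Commutation signs, the monomial basis and the bigraded algebra structure -/

section BiSymLemmas

variable {k : Type*} [Field k] {N : ℕ} {d : Fin N → ℤ × ℤ}

/-- The commutation sign `(-1)^{|a||b|}`. -/
def chi (k : Type*) [Field k] (a b : ℤ × ℤ) : k := sgn k (dot a b)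

theorem chi_comm (a b : ℤ × ℤ) : chi k a b = chi k b a := by rw [chi, chi, dot_comm]

theorem chi_add_left (a b c : ℤ × ℤ) : chi k (a + b) c = chi k a c * chi k b c := by
  rw [chi, dot_add_left, sgn_add]; rfl

theorem chi_add_right (a b c : ℤ × ℤ) : chi k a (b + c) = chi k a b * chi k a c := by
  rw [chi, dot_add_right, sgn_add]; rfl

theorem chi_neg_left (a b : ℤ × ℤ) : chi k (-a) b = chi k a b := by
  rw [chi, dot_neg_left, sgn_neg]; rfl

theorem chi_neg_right (a b : ℤ × ℤ) : chi k a (-b) = chi k a b := by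
  rw [chi, dot_neg_right, sgn_neg]; rfl

theorem chi_sub_left (a b c : ℤ × ℤ) : chi k (a - b) c = chi k a c * chi k b c := by
  rw [chi, dot_sub_left, sgn_sub]; rfl

theorem chi_sub_right (a b c : ℤ × ℤ) : chi k a (b - c) = chi k a b * chi k a c := by
  rw [chi, dot_sub_right, sgn_sub]; rfl

@[simp] theorem chi_zero_left (a : ℤ × ℤ) : chi k 0 a = 1 := by simp [chi]

@[simp] theorem chi_zero_right (a : ℤ × ℤ) : chi k a 0 = 1 := by simp [chi]

theorem chi_eq_one_or (a b : ℤ × ℤ) : chi k a b = 1 ∨ chi k a b = -1 := sgn_eq_one_or k _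

theorem chi_mul_self (a b : ℤ × ℤ) : chi k a b * chi k a b = 1 := sgn_mul_self k _

/-- The condition for an exponent vector to be that of a nonzero monomial. -/
def MonOK (d : Fin N → ℤ × ℤ) (a : Fin N → ℕ) : Prop := ∀ g, Odd (dot (d g) (d g)) → a g ≤ 1

theorem MonOK.mono {a b : Fin N → ℕ} (h : MonOK d b) (hab : a ≤ b) : MonOK d a :=
  fun g hg => (hab g).trans (h g hg)

theorem monOK_zero : MonOK d 0 := fun _ _ => Nat.zero_le 1

open Classical in
/-- The monomial with a given exponent vector, or zero. -/
def mon (k : Type*) [Field k] (d : Fin N → ℤ × ℤ) (a : Fin N → ℕ) : BiSym k d :=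
  if h : MonOK d a then Finsupp.single ⟨a, h⟩ 1 else 0

theorem mon_of_not {a : Fin N → ℕ} (h : ¬ MonOK d a) : mon k d a = 0 := dif_neg h

theorem mon_of {a : Fin N → ℕ} (h : MonOK d a) : mon k d a = Finsupp.single ⟨a, h⟩ 1 := dif_pos h

theorem mon_coe (a : BiMon d) : mon k d a.1 = Finsupp.single a 1 := mon_of a.2

/-- The exponent of the sign in the product of two monomials. -/
def mulExp (d : Fin N → ℤ × ℤ) (a b : Fin N → ℕ) : ℤ :=
  ∑ i, ∑ j ∈ Finset.Iio i, (a i : ℤ) * (b j : ℤ) * dot (d i) (d j)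

theorem mulExp_add_left (a b c : Fin N → ℕ) :
    mulExp d (a + b) c = mulExp d a c + mulExp d b c := by
  simp only [mulExp, ← Finset.sum_add_distrib, Pi.add_apply]
  refine Finset.sum_congr rfl fun i _ => Finset.sum_congr rfl fun j _ => ?_
  push_cast; ring

theorem mulExp_add_right (a b c : Fin N → ℕ) :
    mulExp d a (b + c) = mulExp d a b + mulExp d a c := by
  simp only [mulExp, ← Finset.sum_add_distrib, Pi.add_apply]
  refine Finset.sum_congr rfl fun i _ => Finset.sum_congr rfl fun j _ => ?_
  push_cast; ring

theorem mulExp_single_left (g : Fin N) (b : Fin N → ℕ) :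
    mulExp d (Pi.single g 1) b = ∑ j ∈ Finset.Iio g, (b j : ℤ) * dot (d g) (d j) := by
  rw [mulExp, Finset.sum_eq_single g]
  · simp
  · intro i _ hi
    simp [hi]
  · simp

theorem mul_mon (a b : Fin N → ℕ) (ha : MonOK d a) (hb : MonOK d b) :
    mul k d (mon k d a) (mon k d b) = sgn k (mulExp d a b) • mon k d (a + b) := by
  rw [mon_of ha, mon_of hb, mul, Finsupp.linearCombination_single, one_smul,
    Finsupp.linearCombination_single, one_smul, mulMon, mon]
  by_cases h : MonOK d (a + b)
  · rw [dif_pos h, dif_pos (show ∀ g, _ from h), Finsupp.smul_single, smul_eq_mul, mul_one]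
    rfl
  · rw [dif_neg h, dif_neg (show ¬ ∀ g, _ from h), smul_zero]

theorem mon_zero : mon k d 0 = one k d := mon_of _

theorem mon_single (g : Fin N) : mon k d (Pi.single g 1) = gen k d g := by
  have h : MonOK d (Pi.single g 1) := fun h _ => by
    by_cases e : h = g
    · subst e; simp
    · simp [e]
  exact mon_of h

theorem monOK_single (g : Fin N) : MonOK d (Pi.single g 1) := fun h _ => by
  by_cases e : h = g
  · subst e; simp
  · simp [e]

/-- Degree of an exponent vector. -/
def expDeg (d : Fin N → ℤ × ℤ) (a : Fin N → ℕ) : ℤ × ℤ := ∑ g, a g • d g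

theorem expDeg_add (a b : Fin N → ℕ) : expDeg d (a + b) = expDeg d a + expDeg d b := by
  simp only [expDeg, ← Finset.sum_add_distrib, Pi.add_apply, add_smul]

theorem expDeg_single (g : Fin N) : expDeg d (Pi.single g 1) = d g := by
  rw [expDeg, Finset.sum_eq_single g] <;> simp +contextual

theorem mon_mem (a : Fin N → ℕ) : mon k d a ∈ homog k d (expDeg d a) := by
  by_cases h : MonOK d a
  · rw [mon_of h]
    exact Finsupp.single_mem_supported _ _ rfl
  · rw [mon_of_not h]
    exact zero_mem _

theorem homog_eq_span (D : ℤ × ℤ) :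
    homog k d D = Submodule.span k {x | ∃ a, MonOK d a ∧ expDeg d a = D ∧ x = mon k d a} := by
  rw [homog, Finsupp.supported_eq_span_single]
  congr 1
  ext x
  constructor
  · rintro ⟨a, ha, rfl⟩
    exact ⟨a.1, a.2, ha, (mon_coe a).symm⟩
  · rintro ⟨a, h, ha, rfl⟩
    exact ⟨⟨a, h⟩, ha, (mon_of h).symm⟩

theorem span_mon : Submodule.span k {x | ∃ a, MonOK d a ∧ x = mon k d a} = ⊤ := by
  rw [← Finsupp.supported_univ, Finsupp.supported_eq_span_single]
  congr 1
  ext x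
  constructor
  · rintro ⟨a, h, rfl⟩
    exact ⟨⟨a, h⟩, trivial, (mon_of h).symm⟩
  · rintro ⟨a, -, rfl⟩
    exact ⟨a.1, a.2, (mon_coe a).symm⟩

/-- Induction on monomials, for all elements. -/
theorem mon_induction {p : BiSym k d → Prop} (mon : ∀ a, MonOK d a → p (mon k d a))
    (add : ∀ x y, p x → p y → p (x + y)) (smul : ∀ (c : k) x, p x → p (c • x)) (x) : p x := by
  have hx : x ∈ Submodule.span k {x | ∃ a, MonOK d a ∧ x = BigradedPoisson.mon k d a} := by
    rw [span_mon]; trivial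
  induction hx using Submodule.span_induction with
  | mem x hx => obtain ⟨a, ha, rfl⟩ := hx; exact mon a ha
  | zero => simpa using smul 0 _ (mon 0 fun _ _ => Nat.zero_le 1)
  | add x y _ _ hx hy => exact add x y hx hy
  | smul c x _ hx => exact smul c x hx

/-- Induction on monomials, for homogeneous elements. -/
theorem homog_mon_induction {D : ℤ × ℤ} {p : BiSym k d → Prop}
    (mon : ∀ a, MonOK d a → expDeg d a = D → p (mon k d a)) (zero : p 0)
    (add : ∀ x y, p x → p y → p (x + y)) (smul : ∀ (c : k) x, p x → p (c • x)) :
    ∀ x ∈ homog k d D, p x := by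
  intro x hx
  rw [homog_eq_span] at hx
  induction hx using Submodule.span_induction with
  | mem x hx => obtain ⟨a, ha, hD, rfl⟩ := hx; exact mon a ha hD
  | zero => exact zero
  | add x y _ _ hx hy => exact add x y hx hy
  | smul c x _ hx => exact smul c x hx

/-- On monomials the sign exponent is biadditive, so both bracketings carry the same sign. If the
total exponent vector repeats an odd generator, both sides vanish, even when a partial product does
not. -/
theorem mul_assoc' (x y z : BiSym k d) :
    mul k d (mul k d x y) z = mul k d x (mul k d y z) := by
  induction x using mon_induction with
  | add x x' h h' => simp only [map_add, LinearMap.add_apply, h, h']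
  | smul c x h => simp only [map_smul, LinearMap.smul_apply, h]
  | mon a ha =>
  induction y using mon_induction with
  | add x x' h h' => simp only [map_add, LinearMap.add_apply, h, h']
  | smul c x h => simp only [map_smul, LinearMap.smul_apply, h]
  | mon b hb =>
  induction z using mon_induction with
  | add x x' h h' => simp only [map_add, h, h']
  | smul c x h => simp only [map_smul, h]
  | mon c hc =>
  rw [mul_mon a b ha hb, mul_mon b c hb hc, map_smul, map_smul, LinearMap.smul_apply]
  by_cases h : MonOK d (a + b + c)
  · have h1 : MonOK d (a + b) := h.mono le_self_add
    have h2 : MonOK d (b + c) := h.mono (by rw [add_assoc]; exact le_add_self)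
    rw [mul_mon _ _ h1 hc, mul_mon _ _ ha h2, smul_smul, smul_smul, ← sgn_add, ← sgn_add,
      mulExp_add_left, mulExp_add_right, add_assoc a b c]
    congr 2
    ring
  · have e1 : mul k d (mon k d (a + b)) (mon k d c) = 0 := by
      by_cases h1 : MonOK d (a + b)
      · rw [mul_mon _ _ h1 hc, mon_of_not h, smul_zero]
      · rw [mon_of_not h1, map_zero, LinearMap.zero_apply]
    have e2 : mul k d (mon k d a) (mon k d (b + c)) = 0 := by
      by_cases h1 : MonOK d (b + c)
      · rw [mul_mon _ _ ha h1, ← add_assoc, mon_of_not h, smul_zero]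
      · rw [mon_of_not h1, map_zero]
    rw [e1, e2, smul_zero, smul_zero]

theorem one_mul' (x : BiSym k d) : mul k d (one k d) x = x := by
  induction x using mon_induction with
  | add x x' h h' => simp only [map_add, h, h']
  | smul c x h => simp only [map_smul, h]
  | mon a ha =>
    rw [← mon_zero, mul_mon _ _ monOK_zero ha, zero_add]
    simp [mulExp]

theorem mul_one' (x : BiSym k d) : mul k d x (one k d) = x := by
  induction x using mon_induction with
  | add x x' h h' => simp only [map_add, LinearMap.add_apply, h, h']
  | smul c x h => simp only [map_smul, LinearMap.smul_apply, h]
  | mon a ha =>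
    rw [← mon_zero, mul_mon _ _ ha monOK_zero, add_zero]
    simp [mulExp]

theorem mul_mem_homog {D D' : ℤ × ℤ} {x y : BiSym k d} (hx : x ∈ homog k d D)
    (hy : y ∈ homog k d D') : mul k d x y ∈ homog k d (D + D') := by
  revert x hx
  suffices H : ∀ x ∈ homog k d D, mul k d x y ∈ homog k d (D + D') from fun {x} hx => H x hx
  refine homog_mon_induction (fun a ha hD => ?_) (by simp)
    (fun x x' h h' => by rw [map_add]; exact add_mem h h')
    (fun c x h => by rw [map_smul]; exact Submodule.smul_mem _ _ h)
  revert y hy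
  suffices H : ∀ y ∈ homog k d D', mul k d (mon k d a) y ∈ homog k d (D + D') from
    fun {y} hy => H y hy
  refine homog_mon_induction (fun b hb hD' => ?_) (by simp)
    (fun x x' h h' => by rw [map_add]; exact add_mem h h')
    (fun c x h => by rw [map_smul]; exact Submodule.smul_mem _ _ h)
  rw [mul_mon a b ha hb, ← hD, ← hD', ← expDeg_add]
  exact Submodule.smul_mem _ _ (mon_mem _)

theorem one_mem_homog : one k d ∈ homog k d 0 := by
  rw [← mon_zero]
  simpa [expDeg] using mon_mem (k := k) (d := d) 0

theorem gen_mem_homog (g : Fin N) : gen k d g ∈ homog k d (d g) := by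
  rw [← mon_single]
  simpa [expDeg_single] using mon_mem (k := k) (d := d) (Pi.single g 1)

theorem isInternal_homog : DirectSum.IsInternal (homog k d) := by
  rw [DirectSum.isInternal_submodule_iff_iSupIndep_and_iSup_eq_top]
  constructor
  · intro D
    have h : (⨆ j, ⨆ (_ : j ≠ D), homog k d j) ≤ Finsupp.supported k k {a | monDeg d a ≠ D} :=
      iSup₂_le fun j hj => Finsupp.supported_mono fun a ha h => hj (ha.symm.trans h)
    refine Disjoint.mono_right h ?_
    rw [homog, Finsupp.disjoint_supported_supported_iff, Set.disjoint_left]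
    exact fun a ha ha' => ha' ha
  · rw [eq_top_iff]
    rintro x -
    induction x using mon_induction with
    | mon a ha => exact Submodule.mem_iSup_of_mem _ (mon_mem a)
    | add x y hx hy => exact add_mem hx hy
    | smul c x hx => exact Submodule.smul_mem _ _ hx

/-! ### Generators and derivatives -/

/-- The exponent of the sign for moving the generator `g` past the smaller ones. -/
def leftExp (d : Fin N → ℤ × ℤ) (g : Fin N) (a : Fin N → ℕ) : ℤ :=
  ∑ j ∈ Finset.Iio g, (a j : ℤ) * dot (d g) (d j)

/-- The exponent of the sign for moving the generator `g` past the larger ones. -/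
def rightExp (d : Fin N → ℤ × ℤ) (g : Fin N) (a : Fin N → ℕ) : ℤ :=
  ∑ j ∈ Finset.Ioi g, (a j : ℤ) * dot (d g) (d j)

theorem leftExp_add (g : Fin N) (a b : Fin N → ℕ) :
    leftExp d g (a + b) = leftExp d g a + leftExp d g b := by
  simp only [leftExp, ← Finset.sum_add_distrib, Pi.add_apply]
  refine Finset.sum_congr rfl fun i _ => ?_
  push_cast; ring

theorem leftExp_single (g h : Fin N) :
    leftExp d g (Pi.single h 1) = if h < g then dot (d g) (d h) else 0 := by
  simp only [leftExp, Pi.single_apply]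
  push_cast
  simp

theorem mulExp_single_right (a : Fin N → ℕ) (g : Fin N) :
    mulExp d a (Pi.single g 1) = rightExp d g a := by
  have h (i : Fin N) : (∑ j ∈ Finset.Iio i,
      (a i : ℤ) * ((Pi.single g 1 : Fin N → ℕ) j : ℤ) * dot (d i) (d j)) =
      if i ∈ Finset.Ioi g then (a i : ℤ) * dot (d g) (d i) else 0 := by
    simp only [Pi.single_apply]
    push_cast
    simp [dot_comm]
  rw [mulExp, Finset.sum_congr rfl fun i _ => h i, Finset.sum_ite_mem, Finset.univ_inter, rightExp]

theorem leftExp_add_rightExp (g : Fin N) (a : Fin N → ℕ) :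
    leftExp d g a + rightExp d g a + a g * dot (d g) (d g) = dot (d g) (expDeg d a) := by
  rw [expDeg, dot_sum_right]
  simp only [dot_nsmul_right]
  rw [leftExp, rightExp, ← Finset.sum_add_sum_compl (Finset.Iio g)
    fun i => (a i : ℤ) * dot (d g) (d i)]
  have : (Finset.Iio g)ᶜ = insert g (Finset.Ioi g) := by
    ext i; simp [le_iff_eq_or_lt]
  rw [this, Finset.sum_insert (by simp)]
  ring

theorem gen_mul_mon (g : Fin N) {a : Fin N → ℕ} (ha : MonOK d a) :
    mul k d (gen k d g) (mon k d a) = sgn k (leftExp d g a) • mon k d (Pi.single g 1 + a) := by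
  rw [← mon_single, mul_mon _ _ (monOK_single g) ha, mulExp_single_left, leftExp]

theorem mon_mul_gen (g : Fin N) {a : Fin N → ℕ} (ha : MonOK d a) :
    mul k d (mon k d a) (gen k d g) = sgn k (rightExp d g a) • mon k d (Pi.single g 1 + a) := by
  rw [← mon_single, mul_mon _ _ ha (monOK_single g), mulExp_single_right, add_comm a]

/-- Inserting `g` from the left crosses the smaller generators and from the right the larger ones.
The two signs differ from `(-1)^{|g||x|}` by the factors `g` already present; these matter only for
odd `g`, and then the product is zero. -/
theorem gen_mul_comm (g : Fin N) {D : ℤ × ℤ} :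
    ∀ x ∈ homog k d D, mul k d (gen k d g) x = chi k (d g) D • mul k d x (gen k d g) := by
  refine homog_mon_induction (fun a ha hD => ?_) (by simp)
    (fun x x' h h' => by simp only [map_add, LinearMap.add_apply, smul_add, h, h'])
    (fun c x h => by simp only [map_smul, LinearMap.smul_apply, h]; rw [smul_comm])
  rw [gen_mul_mon g ha, mon_mul_gen g ha, smul_smul]
  by_cases h : MonOK d (Pi.single g 1 + a)
  · congr 1
    have e : sgn k (a g * dot (d g) (d g)) = 1 := ?_
    · rw [chi, ← hD, ← leftExp_add_rightExp, sgn_add, sgn_add, e]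
      linear_combination -sgn k (leftExp d g a) * sgn_mul_self k (rightExp d g a)
    rcases Int.even_or_odd (dot (d g) (d g)) with h1 | h1
    · rw [sgn_of_even k (h1.mul_left _)]
    · have := h g h1
      have h0 : a g = 0 := by simpa using this
      simp [h0]
  · rw [mon_of_not h, smul_zero, smul_zero]

theorem add_sub_single {g : Fin N} {a : Fin N → ℕ} (h : a g ≠ 0) :
    Pi.single g 1 + (a - Pi.single g 1) = a := by
  ext i
  by_cases e : i = g
  · subst e; simp; omega
  · simp [e]

/-- Induction on homogeneous elements, through multiplication by generators. -/
theorem homog_induction {p : ℤ × ℤ → BiSym k d → Prop} (one : p 0 (one k d))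
    (gen_mul : ∀ g D x, x ∈ homog k d D → p D x → p (d g + D) (mul k d (gen k d g) x))
    (add : ∀ D x y, p D x → p D y → p D (x + y)) (smul : ∀ D (c : k) x, p D x → p D (c • x))
    (zero : ∀ D, p D 0) : ∀ D, ∀ x ∈ homog k d D, p D x := by
  intro D
  refine homog_mon_induction (fun a ha hD => ?_) (zero D) (add D) (smul D)
  subst hD
  induction hn : ∑ g, a g generalizing a with
  | zero =>
    have h0 : a = 0 := by
      ext g
      simpa using (Finset.sum_eq_zero_iff.1 hn) g (Finset.mem_univ g)
    subst h0
    rw [mon_zero]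
    simpa [expDeg] using one
  | succ n ih =>
    obtain ⟨g, hg⟩ : ∃ g, a g ≠ 0 := by
      by_contra! h
      simp [h] at hn
    have e := add_sub_single hg
    set b := a - Pi.single g 1 with hb
    have hbOK : MonOK d b := ha.mono (by rw [← e]; exact le_add_self)
    have e1 : mon k d a = sgn k (leftExp d g b) • mul k d (gen k d g) (mon k d b) := by
      rw [gen_mul_mon g hbOK, smul_smul, sgn_mul_self, one_smul, e]
    rw [e1, ← e, expDeg_add, expDeg_single]
    refine smul _ _ _ (gen_mul _ _ _ (mon_mem _) (ih b hbOK ?_))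
    rw [← e] at hn
    simp only [Pi.add_apply, Finset.sum_add_distrib] at hn
    simp at hn
    omega

theorem mul_comm' {D D' : ℤ × ℤ} {x y : BiSym k d} (hx : x ∈ homog k d D) (hy : y ∈ homog k d D') :
    mul k d x y = chi k D D' • mul k d y x := by
  revert D x
  suffices H : ∀ D, ∀ x ∈ homog k d D, mul k d x y = chi k D D' • mul k d y x from
    fun {D x} hx => H D x hx
  refine homog_induction ?_ (fun g D x hx ih => ?_)
    (fun D x x' h h' => by simp only [map_add, LinearMap.add_apply, smul_add, h, h'])
    (fun D c x h => by simp only [map_smul, LinearMap.smul_apply, h]; rw [smul_comm]) (by simp)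
  · rw [one_mul', chi_zero_left, one_smul]
    exact (mul_one' y).symm
  · rw [mul_assoc', ih, map_smul, ← mul_assoc', gen_mul_comm g y hy, map_smul, LinearMap.smul_apply,
      mul_assoc', smul_smul, chi_add_left, _root_.mul_comm]

theorem leftDeriv_mon (g : Fin N) {a : Fin N → ℕ} (ha : MonOK d a) :
    leftDeriv k d g (mon k d a) =
      ((a g : k) * sgn k (leftExp d g a)) • mon k d (a - Pi.single g 1) := by
  rw [mon_of ha, leftDeriv, Finsupp.linearCombination_single, one_smul,
    mon_of (ha.mono tsub_le_self), Finsupp.smul_single, smul_eq_mul, mul_one]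
  rfl

theorem rightDeriv_mon (g : Fin N) {a : Fin N → ℕ} (ha : MonOK d a) :
    rightDeriv k d g (mon k d a) =
      ((a g : k) * sgn k (rightExp d g a)) • mon k d (a - Pi.single g 1) := by
  rw [mon_of ha, rightDeriv, Finsupp.linearCombination_single, one_smul,
    mon_of (ha.mono tsub_le_self), Finsupp.smul_single, smul_eq_mul, mul_one]
  rfl

/-- The sign is that of moving the removed factor `g` across the remaining ones, of total bidegree
`D - |g|`. -/
theorem rightDeriv_eq (g : Fin N) {D : ℤ × ℤ} :
    ∀ x ∈ homog k d D, rightDeriv k d g x = chi k (d g) (D - d g) • leftDeriv k d g x := by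
  refine homog_mon_induction (fun a ha hD => ?_) (by simp)
    (fun x x' h h' => by simp only [map_add, smul_add, h, h'])
    (fun c x h => by simp only [map_smul, h]; rw [smul_comm])
  rw [rightDeriv_mon g ha, leftDeriv_mon g ha, smul_smul]
  congr 1
  by_cases h0 : a g = 0
  · simp [h0]
  rw [chi_sub_right, chi, ← hD, ← leftExp_add_rightExp, sgn_add, sgn_add, chi]
  have e : sgn k (a g * dot (d g) (d g)) * sgn k (dot (d g) (d g)) = 1 := by
    rcases Int.even_or_odd (dot (d g) (d g)) with h1 | h1
    · rw [sgn_of_even k (h1.mul_left _), sgn_of_even k h1, mul_one]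
    · have : a g = 1 := le_antisymm (ha g h1) (Nat.one_le_iff_ne_zero.2 h0)
      rw [this, Nat.cast_one, _root_.one_mul, sgn_mul_self]
  linear_combination -(a g : k) * sgn k (leftExp d g a) * sgn k (leftExp d g a) *
    sgn k (rightExp d g a) * e - (a g : k) * sgn k (rightExp d g a) * sgn_mul_self k (leftExp d g a)

theorem leftDeriv_mem_homog (g : Fin N) {D : ℤ × ℤ} :
    ∀ x ∈ homog k d D, leftDeriv k d g x ∈ homog k d (D - d g) := by
  refine homog_mon_induction (fun a ha hD => ?_) (by simp)
    (fun x x' h h' => by rw [map_add]; exact add_mem h h')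
    (fun c x h => by rw [map_smul]; exact Submodule.smul_mem _ _ h)
  rw [leftDeriv_mon g ha]
  by_cases h0 : a g = 0
  · simp [h0]
  · refine Submodule.smul_mem _ _ ?_
    have := mon_mem (k := k) (d := d) (a - Pi.single g 1)
    rwa [show expDeg d (a - Pi.single g 1) = D - d g by
      rw [← hD, ← add_sub_single h0, expDeg_add, expDeg_single]; simp [add_sub_single h0]] at this

theorem rightDeriv_mem_homog (g : Fin N) {D : ℤ × ℤ} (x) (hx : x ∈ homog k d D) :
    rightDeriv k d g x ∈ homog k d (D - d g) := by
  rw [rightDeriv_eq g x hx]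
  exact Submodule.smul_mem _ _ (leftDeriv_mem_homog g x hx)

theorem leftDeriv_one (g : Fin N) : leftDeriv k d g (one k d) = 0 := by
  rw [← mon_zero, leftDeriv_mon g monOK_zero]
  simp

/-- The graded Heisenberg relation between a derivative and multiplication by a generator. With
induction through generators, it carries all later computations with derivatives. -/
theorem leftDeriv_gen_mul (g h : Fin N) (x : BiSym k d) :
    leftDeriv k d g (mul k d (gen k d h) x) =
      (if g = h then x else 0) + chi k (d g) (d h) • mul k d (gen k d h) (leftDeriv k d g x) := by
  induction x using mon_induction with
  | add x x' h1 h2 =>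
    simp only [map_add, h1, h2]
    split_ifs <;> module
  | smul c x h1 =>
    simp only [map_smul, h1]
    split_ifs <;> module
  | mon a ha =>
  have haL : MonOK d (a - Pi.single g 1) := ha.mono tsub_le_self
  rw [gen_mul_mon h ha, map_smul, leftDeriv_mon g ha, map_smul, gen_mul_mon h haL]
  by_cases e : g = h
  · subst e
    rw [if_pos rfl]
    by_cases h0 : a g = 0
    · have hOK : MonOK d (Pi.single g 1 + a) := fun i hi => by
        by_cases e : i = g
        · subst e; simp [h0]
        · simpa [e] using ha i hi
      rw [leftDeriv_mon g hOK, leftExp_add, leftExp_single, if_neg (lt_irrefl g), zero_add,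
        add_tsub_cancel_left]
      simp [h0, smul_smul, sgn_mul_self]
    · have e1 : leftExp d g (a - Pi.single g 1) = leftExp d g a := by
        conv_rhs => rw [← add_sub_single h0]
        rw [leftExp_add, leftExp_single, if_neg (lt_irrefl g), zero_add]
      rw [e1, add_sub_single h0]
      rcases Int.even_or_odd (dot (d g) (d g)) with h1 | h1
      · have hOK : MonOK d (Pi.single g 1 + a) := fun i hi => by
          by_cases e : i = g
          · subst e; exact absurd h1 (Int.not_even_iff_odd.2 hi)
          · simpa [e] using ha i hi
        rw [leftDeriv_mon g hOK, leftExp_add, leftExp_single, if_neg (lt_irrefl g), zero_add,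
          add_tsub_cancel_left, chi, sgn_of_even k h1, one_smul]
        have h2 := sgn_mul_self k (leftExp d g a)
        simp only [smul_smul, Pi.add_apply, Pi.single_eq_same]
        push_cast
        match_scalars
        linear_combination h2
      -- For `g` odd and already present in `x`, the left side is zero because `g x = 0`, and on the
      -- right `g ∂_g x = x` cancels the term `x`.
      · have hOK : ¬ MonOK d (Pi.single g 1 + a) := fun hh => h0 (by simpa using hh g h1)
        have h2 : a g = 1 := le_antisymm (ha g h1) (Nat.one_le_iff_ne_zero.2 h0)
        rw [mon_of_not hOK, map_zero, smul_zero, chi, sgn_of_odd k h1, h2, Nat.cast_one,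
          _root_.one_mul]
        rcases sgn_eq_one_or k (leftExp d g a) with h4 | h4 <;> rw [h4] <;> module
  · rw [if_neg e, zero_add]
    by_cases h0 : a g = 0
    · by_cases hOK : MonOK d (Pi.single h 1 + a)
      · rw [leftDeriv_mon g hOK]
        simp [h0, e]
      · rw [mon_of_not hOK]
        simp [h0]
    · have e2 : Pi.single h 1 + a - Pi.single g 1 = Pi.single h 1 + (a - Pi.single g 1) := by
        ext i
        by_cases ei : i = g
        · subst ei; simp [e]
        · simp [ei]
      by_cases hOK : MonOK d (Pi.single h 1 + a)
      · rw [leftDeriv_mon g hOK, e2]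
        simp only [smul_smul]
        congr 1
        have e3 : leftExp d h a = leftExp d h (Pi.single g 1) + leftExp d h (a - Pi.single g 1) := by
          rw [← leftExp_add, add_sub_single h0]
        have e4 : sgn k (leftExp d h (Pi.single g 1)) * sgn k (leftExp d g (Pi.single h 1)) =
            chi k (d g) (d h) := by
          rw [leftExp_single, leftExp_single, chi]
          rcases lt_or_gt_of_ne e with h1 | h1
          · rw [if_pos h1, if_neg h1.not_gt, sgn_zero, mul_one, dot_comm]
          · rw [if_pos h1, if_neg h1.not_gt, sgn_zero, _root_.one_mul]
        rw [e3, leftExp_add, sgn_add, sgn_add, ← e4]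
        simp [e]
        ring
      -- Removing `g ≠ h` does not lower the exponent of `h`, so both products vanish for the same
      -- reason.
      · have hOK' : ¬ MonOK d (Pi.single h 1 + (a - Pi.single g 1)) := fun hh => hOK fun i hi => by
          by_cases ei : i = g
          · subst ei; simpa [e] using ha i hi
          · simpa [ei] using hh i hi
        rw [mon_of_not hOK, mon_of_not hOK']
        simp

theorem leftDeriv_mul (g : Fin N) (y : BiSym k d) : ∀ (D : ℤ × ℤ), ∀ x ∈ homog k d D,
    leftDeriv k d g (mul k d x y) =
      mul k d (leftDeriv k d g x) y + chi k (d g) D • mul k d x (leftDeriv k d g y) := by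
  refine homog_induction ?_ (fun h D x hx ih => ?_)
    (fun D x x' h h' => by
      simp only [map_add, LinearMap.add_apply, smul_add, h, h']; abel)
    (fun D c x h => by simp only [map_smul, LinearMap.smul_apply, h]; module) (by simp)
  · simp [one_mul', leftDeriv_one]
  · rw [mul_assoc', leftDeriv_gen_mul, leftDeriv_gen_mul, ih, chi_add_right]
    simp only [map_add, map_smul, LinearMap.add_apply, LinearMap.smul_apply, mul_assoc', smul_add,
      smul_smul]
    split_ifs <;> simp [add_assoc]

theorem leftDeriv_leftDeriv (g h : Fin N) (x : BiSym k d) :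
    leftDeriv k d g (leftDeriv k d h x) =
      chi k (d g) (d h) • leftDeriv k d h (leftDeriv k d g x) := by
  induction x using mon_induction with
  | add x x' h1 h2 => simp only [map_add, h1, h2, smul_add]
  | smul c x h1 => simp only [map_smul, h1]; rw [smul_comm]
  | mon a ha =>
  revert ha
  suffices H : ∀ D, ∀ x ∈ homog k d D, leftDeriv k d g (leftDeriv k d h x) =
      chi k (d g) (d h) • leftDeriv k d h (leftDeriv k d g x) from fun _ => H _ _ (mon_mem a)
  refine homog_induction ?_ (fun p D x hx ih => ?_)
    (fun D x x' h h' => by simp only [map_add, smul_add, h, h'])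
    (fun D c x h => by simp only [map_smul, h]; rw [smul_comm]) (by simp)
  · simp [leftDeriv_one]
  · have h3 := chi_mul_self (k := k) (d g) (d h)
    simp only [leftDeriv_gen_mul, map_add, map_smul, ih, smul_add, apply_ite (leftDeriv k d g),
      apply_ite (leftDeriv k d h), map_zero]
    by_cases e1 : g = p <;> by_cases e2 : h = p
    · subst e1; subst e2
      simp only [if_true]
      rcases chi_eq_one_or (k := k) (d h) (d h) with h4 | h4 <;> simp only [h4] <;> module
    · subst e1
      simp only [if_true, if_neg e2, chi_comm (d h) (d g)]
      rcases chi_eq_one_or (k := k) (d g) (d h) with h4 | h4 <;> simp only [h4] <;> module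
    · subst e2
      simp only [if_true, if_neg e1]
      rcases chi_eq_one_or (k := k) (d g) (d h) with h4 | h4 <;> simp only [h4] <;> module
    · simp only [if_neg e1, if_neg e2]
      module

end BiSymLemmas

/-! ### Ordered products of graded commuting operators -/

section Ordered

variable {k : Type*} [Field k] {A : Type*} [Ring A] [Algebra k A]

theorem leftExp_succ {N : ℕ} (d : Fin (N + 1) → ℤ × ℤ) (g : Fin N) (a : Fin (N + 1) → ℕ) :
    leftExp d g.succ a = a 0 * dot (d g.succ) (d 0) +
      leftExp (fun i => d i.succ) g fun i => a i.succ := by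
  simp only [leftExp]
  have h (n : ℕ) (i : Fin n) (f : Fin n → ℤ) :
      ∑ j ∈ Finset.Iio i, f j = ∑ j, if j < i then f j else 0 := by
    rw [← Finset.sum_filter]
    congr 1
    ext j; simp
  rw [h, h, Fin.sum_univ_succ]
  simp

/-- Inserting a factor into an ordered product of powers of graded commuting elements. -/
theorem mul_prod_ofFn {N : ℕ} (d : Fin N → ℤ × ℤ) (C : Fin N → A)
    (hC : ∀ g h, g ≠ h → C g * C h = chi k (d g) (d h) • (C h * C g)) (g : Fin N)
    (a : Fin N → ℕ) :
    C g * (List.ofFn fun j => C j ^ a j).prod =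
      sgn k (leftExp d g a) •
        (List.ofFn fun j => C j ^ ((Pi.single g 1 : Fin N → ℕ) + a) j).prod := by
  induction N with
  | zero => exact g.elim0
  | succ N ih =>
    rw [List.ofFn_succ, List.ofFn_succ, List.prod_cons, List.prod_cons]
    cases g using Fin.cases with
    | zero =>
      have h0 : leftExp d 0 a = 0 :=
        Finset.sum_eq_zero fun j hj => absurd (Finset.mem_Iio.1 hj) (Fin.not_lt_zero j)
      rw [h0, sgn_zero, one_smul, ← mul_assoc]
      congr 1
      · simp [pow_add]
      · simp
    | succ g =>
      -- Moving the new factor past the first power contributes the `j = 0` term of `leftExp`; the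
      -- induction hypothesis gives the others.
      have hpow (n : ℕ) : C g.succ * C 0 ^ n =
          sgn k (n * dot (d g.succ) (d 0)) • (C 0 ^ n * C g.succ) := by
        induction n with
        | zero => simp
        | succ n ihn =>
          rw [pow_succ, ← mul_assoc, ihn, smul_mul_assoc, mul_assoc, hC _ _ (Fin.succ_ne_zero g),
            mul_smul_comm, smul_smul, chi, ← sgn_add, mul_assoc]
          congr 2
          push_cast; ring
      have := ih (fun i => d i.succ) (fun i => C i.succ)
        (fun g h hgh => hC _ _ fun e => hgh (Fin.succ_injective _ e)) g fun i => a i.succ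
      rw [← mul_assoc, hpow, smul_mul_assoc, mul_assoc, this, mul_smul_comm, smul_smul, ← sgn_add,
        leftExp_succ]
      congr 2
      · congr 1
        simp
      · congr 2
        funext j
        simp [Pi.single_apply, Fin.succ_inj]

end Ordered

/-! ### Conjugate coordinates -/

section Mixed

variable {l : ℕ} (e : Fin l → ℤ × ℤ)

@[simp] theorem polyDeg_fstG (i : Fin l) : polyDeg e (fstG i) = e i := Fin.append_left _ _ _

@[simp] theorem polyDeg_sndG (i : Fin l) : polyDeg e (sndG i) = -e i - (0, 1) :=
  Fin.append_right _ _ _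

@[simp] theorem mixedDeg_fstG (i : Fin l) : mixedDeg e (fstG i) = baseDeg e i :=
  Fin.append_left _ _ _

@[simp] theorem mixedDeg_sndG (i : Fin l) : mixedDeg e (sndG i) = baseDeg e i + (0, 1) :=
  Fin.append_right _ _ _

theorem fstG_ne_sndG (i j : Fin l) : fstG i ≠ sndG j := fun h => by
  have := congrArg Fin.val h
  simp only [fstG, sndG, Fin.val_castAdd, Fin.val_natAdd] at this
  omega

theorem fstG_inj {i j : Fin l} : fstG i = fstG j ↔ i = j := Fin.castAdd_inj

theorem sndG_inj {i j : Fin l} : sndG i = sndG j ↔ i = j := Fin.natAdd_inj _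

open Classical in
/-- The position of `u_i` among the generators of the polyvectors. -/
def uG (i : Fin l) : Fin (l + l) := if IsEvenCoord e i then fstG i else sndG i

open Classical in
/-- The position of `v_i` among the generators of the polyvectors. -/
def vG (i : Fin l) : Fin (l + l) := if IsEvenCoord e i then sndG i else fstG i

open Classical in
/-- The scalar `[v_i, u_i]`. -/
def conjScalar (k : Type*) [Field k] (i : Fin l) : k :=
  if IsEvenCoord e i then 1 else conjSign e k i

theorem polyDeg_uG (i : Fin l) : polyDeg e (uG e i) = baseDeg e i := by
  rw [uG, baseDeg]
  split_ifs <;> simp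

theorem polyDeg_vG (i : Fin l) : polyDeg e (vG e i) = -baseDeg e i - (0, 1) := by
  rw [vG, baseDeg]
  split_ifs <;> simp

theorem uG_ne_vG (i j : Fin l) : uG e i ≠ vG e j := by
  rw [uG, vG]
  by_cases h : i = j
  · subst h
    split_ifs
    · exact fstG_ne_sndG _ _
    · exact (fstG_ne_sndG _ _).symm
  · split_ifs
    · exact fstG_ne_sndG _ _
    · rwa [Ne, fstG_inj]
    · rwa [Ne, sndG_inj]
    · exact (fstG_ne_sndG _ _).symm

theorem uG_inj {i j : Fin l} : uG e i = uG e j ↔ i = j := by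
  refine ⟨fun h => ?_, fun h => h ▸ rfl⟩
  rw [uG, uG] at h
  split_ifs at h
  · exact fstG_inj.1 h
  · exact absurd h (fstG_ne_sndG _ _)
  · exact absurd h.symm (fstG_ne_sndG _ _)
  · exact sndG_inj.1 h

theorem vG_inj {i j : Fin l} : vG e i = vG e j ↔ i = j := by
  refine ⟨fun h => ?_, fun h => h ▸ rfl⟩
  rw [vG, vG] at h
  split_ifs at h
  · exact sndG_inj.1 h
  · exact absurd h.symm (fstG_ne_sndG _ _)
  · exact absurd h (fstG_ne_sndG _ _)
  · exact fstG_inj.1 h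

theorem eq_uG_or_eq_vG (g : Fin (l + l)) : (∃ i, g = uG e i) ∨ ∃ i, g = vG e i := by
  induction g using Fin.addCases with
  | left i =>
    by_cases h : IsEvenCoord e i
    · exact Or.inl ⟨i, by rw [uG, if_pos h]; rfl⟩
    · exact Or.inr ⟨i, by rw [vG, if_neg h]; rfl⟩
  | right i =>
    by_cases h : IsEvenCoord e i
    · exact Or.inr ⟨i, by rw [vG, if_pos h]; rfl⟩
    · exact Or.inl ⟨i, by rw [uG, if_neg h]; rfl⟩

/-- This is the point of mixed forms. Since `p² + w²` and `p + w` have the same parity, and passing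
from `z_i` to `∂_i` changes that of `p + w`, every `u_i` commutes with itself. Adding `(0,1)` then
makes every `d̃u_i` anticommute with itself. -/
theorem even_baseDeg (i : Fin l) : Even (dot (baseDeg e i) (baseDeg e i)) := by
  rw [baseDeg]
  split_ifs with h
  · rw [IsEvenCoord, Int.even_add] at h
    simpa only [dot, Int.even_add, Int.even_mul, or_self] using h
  · rw [IsEvenCoord, Int.even_add] at h
    simp only [dot, Prod.fst_sub, Prod.snd_sub, Prod.fst_neg, Prod.snd_neg, sub_zero, Int.even_add,
      Int.even_sub, Int.even_mul, or_self, even_neg, Int.not_even_one, iff_false]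
    tauto

variable (k : Type*) [Field k]

theorem chi_baseDeg_self (i : Fin l) : chi k (baseDeg e i) (baseDeg e i) = 1 :=
  sgn_of_even k (even_baseDeg e i)

theorem chi_weight_self : chi k (0, 1) (0, 1) = -1 := by simp [chi, dot]

theorem contractGen_uG (i : Fin l) :
    contractGen e k (uG e i) = mul k (mixedDeg e) (gen k (mixedDeg e) (fstG i)) := by
  rw [uG, contractGen]
  split_ifs with h
  · rw [fstG, Fin.append_left, if_pos h]; rfl
  · rw [sndG, Fin.append_right, if_neg h]

theorem contractGen_vG (i : Fin l) :
    contractGen e k (vG e i) = conjScalar e k i • leftDeriv k (mixedDeg e) (sndG i) := by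
  rw [vG, contractGen, conjScalar]
  split_ifs with h
  · rw [sndG, Fin.append_right, if_pos h, one_smul]; rfl
  · rw [fstG, Fin.append_left, if_neg h]

/-- Rewriting the bracket in the conjugate pairs `(u_i, v_i)` gives one formula for even and odd
coordinates, in the form that the commutators with `d̃` produce. -/
theorem schouten_eq (P Q : Polyvector e k) :
    schouten e k P Q = ∑ i, (conjScalar e k i • mul k (polyDeg e)
        (rightDeriv k (polyDeg e) (vG e i) P) (leftDeriv k (polyDeg e) (uG e i) Q) -
      (chi k (0, 1) (baseDeg e i) * conjScalar e k i) • mul k (polyDeg e)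
        (rightDeriv k (polyDeg e) (uG e i) P) (leftDeriv k (polyDeg e) (vG e i) Q)) := by
  rw [schouten, LinearMap.sum_apply, LinearMap.sum_apply]
  refine Finset.sum_congr rfl fun i _ => ?_
  simp only [LinearMap.add_apply, LinearMap.smul_apply, LinearMap.compl₁₂_apply]
  by_cases h : IsEvenCoord e i
  · simp only [uG, vG, conjScalar, baseDeg, if_pos h, conjSign, chi, dot]
    rw [IsEvenCoord] at h
    have : sgn k (0 * (e i).1 + 1 * (e i).2) = sgn k (e i).1 := by
      rw [zero_mul, one_mul, zero_add]
      have h1 := sgn_of_even k h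
      rw [sgn_add] at h1
      linear_combination sgn k (e i).1 * h1 - sgn k (e i).2 * sgn_mul_self k (e i).1
    rw [this]
    module
  · simp only [uG, vG, conjScalar, baseDeg, if_neg h, conjSign, chi, dot]
    rw [IsEvenCoord, Int.not_even_iff_odd] at h
    have : sgn k (0 * (-e i - (0, 1)).1 + 1 * (-e i - (0, 1)).2) * sgn k (e i).1 = 1 := by
      rw [← sgn_add]
      refine sgn_of_even k ?_
      simp only [Prod.snd_sub, Prod.snd_neg]
      grind
    rw [mul_neg, this]
    module

theorem mixedD_apply (β : MixedForm e k) :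
    mixedD e k β = ∑ i, mul k (mixedDeg e) (gen k (mixedDeg e) (sndG i))
      (leftDeriv k (mixedDeg e) (fstG i) β) := by
  rw [mixedD, LinearMap.sum_apply]
  rfl

variable {k}

/-! ### Multiplicativity of the contraction -/

theorem gen_gen_mul {N : ℕ} {d : Fin N → ℤ × ℤ} (g h : Fin N) (x : BiSym k d) :
    mul k d (gen k d g) (mul k d (gen k d h) x) =
      chi k (d g) (d h) • mul k d (gen k d h) (mul k d (gen k d g) x) := by
  rw [← mul_assoc', gen_mul_comm g _ (gen_mem_homog h), map_smul, LinearMap.smul_apply, mul_assoc']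

/-- Even conjugate generators commute after contraction: `u_i` acts by multiplication, while `v_i`
differentiates with respect to the different generator `d̃u_i`. -/
theorem contractGen_comm {g h : Fin (l + l)} (hgh : g ≠ h) :
    contractGen e k g * contractGen e k h =
      chi k (polyDeg e g) (polyDeg e h) • (contractGen e k h * contractGen e k g) := by
  refine LinearMap.ext fun β => ?_
  simp only [Module.End.mul_apply, LinearMap.smul_apply]
  rcases eq_uG_or_eq_vG e g with ⟨i, rfl⟩ | ⟨i, rfl⟩ <;>
  rcases eq_uG_or_eq_vG e h with ⟨j, rfl⟩ | ⟨j, rfl⟩ <;>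
  simp only [contractGen_uG, contractGen_vG, polyDeg_uG, polyDeg_vG, LinearMap.smul_apply,
    map_smul]
  · rw [gen_gen_mul, mixedDeg_fstG, mixedDeg_fstG]
  · rw [leftDeriv_gen_mul, if_neg (fstG_ne_sndG i j).symm, mixedDeg_fstG, mixedDeg_sndG]
    simp only [chi_sub_right, chi_neg_right, zero_add, chi_comm (k := k) _ (baseDeg e i),
      chi_add_right]
    rcases chi_eq_one_or (k := k) (baseDeg e i) (baseDeg e j) with h1 | h1 <;>
    rcases chi_eq_one_or (k := k) (baseDeg e i) (0, 1) with h2 | h2 <;>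
    simp only [h1, h2] <;> module
  · rw [leftDeriv_gen_mul, if_neg (fstG_ne_sndG j i).symm, mixedDeg_fstG, mixedDeg_sndG]
    simp only [chi_add_left, chi_sub_left, chi_neg_left, zero_add]
    module
  · rw [leftDeriv_leftDeriv, mixedDeg_sndG, mixedDeg_sndG]
    simp only [chi_add_left, chi_sub_left, chi_neg_left, chi_add_right, chi_sub_right,
      chi_neg_right]
    module

/-- An odd generator must be some `v_i`, which acts by a multiple of an odd derivative. Such a
derivative anticommutes with itself, so its square is zero in characteristic zero. -/
theorem contractGen_sq [CharZero k] {g : Fin (l + l)}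
    (hg : Odd (dot (polyDeg e g) (polyDeg e g))) : contractGen e k g * contractGen e k g = 0 := by
  rcases eq_uG_or_eq_vG e g with ⟨i, rfl⟩ | ⟨i, rfl⟩
  · rw [polyDeg_uG] at hg
    exact absurd (even_baseDeg e i) (Int.not_even_iff_odd.2 hg)
  · refine LinearMap.ext fun β => ?_
    have h1 := leftDeriv_leftDeriv (sndG i) (sndG i) β
    rw [mixedDeg_sndG] at h1
    simp only [chi_add_left, chi_add_right, chi_baseDeg_self, chi_weight_self,
      chi_comm (k := k) (0, 1) (baseDeg e i)] at h1
    have h2 : leftDeriv k (mixedDeg e) (sndG i) (leftDeriv k (mixedDeg e) (sndG i) β) = 0 := by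
      have h3 : (2 : k) • leftDeriv k (mixedDeg e) (sndG i)
          (leftDeriv k (mixedDeg e) (sndG i) β) = 0 := by
        rcases chi_eq_one_or (k := k) (baseDeg e i) (0, 1) with h2 | h2 <;>
        simp only [h2] at h1 <;> linear_combination (norm := module) h1
      exact (smul_eq_zero.1 h3).resolve_left two_ne_zero
    simp [contractGen_vG, h2]

theorem contract_mon {a : Fin (l + l) → ℕ} (ha : MonOK (polyDeg e) a) :
    contract e k (mon k (polyDeg e) a) = (List.ofFn fun g => contractGen e k g ^ a g).prod := by
  rw [mon_of ha, contract, Finsupp.linearCombination_single, one_smul]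

theorem contract_one : contract e k (one k (polyDeg e)) = 1 := by
  rw [← mon_zero, contract_mon e monOK_zero]
  simp

/-- The contraction operators satisfy the same commutation relations as the generators, so inserting
`g` into an ordered product costs the same sign on both sides. -/
theorem contract_gen_mul [CharZero k] (g : Fin (l + l)) (x : Polyvector e k) :
    contract e k (mul k (polyDeg e) (gen k (polyDeg e) g) x) =
      contractGen e k g * contract e k x := by
  induction x using mon_induction with
  | add x y hx hy => simp only [map_add, hx, hy, mul_add]
  | smul c x hx => simp only [map_smul, hx, mul_smul_comm]
  | mon a ha =>
    rw [gen_mul_mon g ha, map_smul, contract_mon e ha,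
      mul_prod_ofFn (polyDeg e) (contractGen e k) (fun g h hgh => contractGen_comm e hgh)]
    by_cases h : MonOK (polyDeg e) (Pi.single g 1 + a)
    · rw [contract_mon e h]
    · rw [mon_of_not h, map_zero, smul_zero]
      -- The product of polyvectors is zero here; the ordered product of operators vanishes too, as
      -- it contains the square of an odd generator's contraction.
      obtain ⟨i, hi, h2⟩ : ∃ i, Odd (dot (polyDeg e i) (polyDeg e i)) ∧
          2 ≤ ((Pi.single g 1 : Fin (l + l) → ℕ) + a) i := by
        simpa [MonOK, Nat.lt_iff_add_one_le] using h
      rw [List.prod_eq_zero, smul_zero]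
      rw [List.mem_ofFn]
      refine ⟨i, ?_⟩
      obtain ⟨n, hn⟩ := Nat.exists_eq_add_of_le h2
      rw [hn, pow_add, pow_two, contractGen_sq e hi, zero_mul]

theorem contract_mul [CharZero k] (x y : Polyvector e k) :
    contract e k (mul k (polyDeg e) x y) = contract e k x * contract e k y := by
  induction x using mon_induction with
  | add x x' h h' => simp only [map_add, LinearMap.add_apply, add_mul, h, h']
  | smul c x h => simp only [map_smul, LinearMap.smul_apply, smul_mul_assoc, h]
  | mon a ha =>
  revert ha
  suffices H : ∀ D, ∀ x ∈ homog k (polyDeg e) D, contract e k (mul k (polyDeg e) x y) =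
      contract e k x * contract e k y from fun _ => H _ _ (mon_mem a)
  refine homog_induction ?_ (fun p D x hx ih => ?_)
    (fun D x x' h h' => by simp only [map_add, LinearMap.add_apply, add_mul, h, h'])
    (fun D c x h => by simp only [map_smul, LinearMap.smul_apply, smul_mul_assoc, h]) (by simp)
  · rw [one_mul', contract_one, one_mul]
  · rw [mul_assoc', contract_gen_mul, contract_gen_mul, ih, mul_assoc]

end Mixed

/-! ### Commutators of the differential with contractions -/

section Commutators

variable {l : ℕ} {e : Fin l → ℤ × ℤ} {k : Type*} [Field k]

/-- An operator with scalar graded commutator with the generators acts on contractions as a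
partial derivative. -/
theorem apply_contract_of_contractGen [CharZero k] (Z : Module.End k (MixedForm e k)) (c : k)
    (g : Fin (l + l))
    (hZ : ∀ h β, Z (contractGen e k h β) = (if g = h then c • β else 0) +
      chi k (polyDeg e g) (polyDeg e h) • contractGen e k h (Z β)) (β : MixedForm e k) :
    ∀ D, ∀ x ∈ homog k (polyDeg e) D, Z (contract e k x β) =
      c • contract e k (leftDeriv k (polyDeg e) g x) β +
        chi k (polyDeg e g) D • contract e k x (Z β) := by
  refine homog_induction ?_ (fun p D x hx ih => ?_)
    (fun D x x' h h' => by simp only [map_add, LinearMap.add_apply, h, h']; module)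
    (fun D c x h => by simp only [map_smul, LinearMap.smul_apply, h]; module) (by simp)
  · simp [leftDeriv_one, contract_one]
  · rw [leftDeriv_gen_mul, contract_gen_mul, Module.End.mul_apply, hZ, ih]
    simp only [map_add, map_smul, contract_gen_mul, LinearMap.add_apply, LinearMap.smul_apply,
      Module.End.mul_apply, chi_add_right]
    split_ifs
    · module
    · simp only [map_zero, LinearMap.zero_apply]; module

/-- Among the contraction generators, `∂/∂u_i` fails to graded commute only with multiplication by
`u_i`, so its commutator with a contraction differentiates the polyvector in `u_i`. -/
theorem leftDeriv_contract [CharZero k] (i : Fin l) {D : ℤ × ℤ} {x : Polyvector e k}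
    (hx : x ∈ homog k (polyDeg e) D) (β : MixedForm e k) :
    leftDeriv k (mixedDeg e) (fstG i) (contract e k x β) =
      contract e k (leftDeriv k (polyDeg e) (uG e i) x) β +
        chi k (baseDeg e i) D • contract e k x (leftDeriv k (mixedDeg e) (fstG i) β) := by
  have := apply_contract_of_contractGen (leftDeriv k (mixedDeg e) (fstG i)) 1 (uG e i)
    (fun h β => ?_) β D x hx
  · rwa [one_smul, polyDeg_uG] at this
  · rcases eq_uG_or_eq_vG e h with ⟨j, rfl⟩ | ⟨j, rfl⟩
    · simp only [contractGen_uG, leftDeriv_gen_mul, fstG_inj, uG_inj, polyDeg_uG, mixedDeg_fstG,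
        one_smul]
    · simp only [contractGen_vG, LinearMap.smul_apply, map_smul, if_neg (uG_ne_vG e i j),
        polyDeg_uG, polyDeg_vG]
      rw [leftDeriv_leftDeriv, mixedDeg_fstG, mixedDeg_sndG]
      simp only [chi_add_right, chi_sub_right, chi_neg_right]
      module

/-- Dually, multiplication by `d̃u_i` fails to graded commute only with the contraction by `v_i`,
where the discrepancy is `[v_i, u_i]`. -/
theorem genMul_contract [CharZero k] (i : Fin l) {D : ℤ × ℤ} {x : Polyvector e k}
    (hx : x ∈ homog k (polyDeg e) D) (β : MixedForm e k) :
    mul k (mixedDeg e) (gen k (mixedDeg e) (sndG i)) (contract e k x β) =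
      conjScalar e k i • contract e k (leftDeriv k (polyDeg e) (vG e i) x) β +
        (chi k (baseDeg e i) D * chi k (0, 1) D) •
          contract e k x (mul k (mixedDeg e) (gen k (mixedDeg e) (sndG i)) β) := by
  have := apply_contract_of_contractGen (mul k (mixedDeg e) (gen k (mixedDeg e) (sndG i)))
    (conjScalar e k i) (vG e i) (fun h β => ?_) β D x hx
  · rwa [polyDeg_vG, chi_sub_left, chi_neg_left] at this
  · rcases eq_uG_or_eq_vG e h with ⟨j, rfl⟩ | ⟨j, rfl⟩
    · simp only [contractGen_uG, if_neg (uG_ne_vG e j i).symm, polyDeg_uG, polyDeg_vG]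
      rw [gen_gen_mul, mixedDeg_fstG, mixedDeg_sndG]
      simp only [chi_add_left, chi_sub_left, chi_neg_left]
      module
    · simp only [contractGen_vG, LinearMap.smul_apply, map_smul, polyDeg_vG, leftDeriv_gen_mul,
        mixedDeg_sndG, vG_inj, sndG_inj]
      simp only [chi_add_left, chi_sub_left, chi_neg_left, chi_add_right, chi_sub_right,
        chi_neg_right]
      by_cases h : i = j
      · subst h
        simp only [if_true, chi_baseDeg_self, chi_weight_self, chi_comm (k := k) (0, 1) (baseDeg e i)]
        rcases chi_eq_one_or (k := k) (baseDeg e i) (0, 1) with h2 | h2 <;> simp only [h2] <;>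
        module
      · simp only [if_neg h, if_neg (Ne.symm h), chi_comm (k := k) (baseDeg e j),
          chi_comm (k := k) (0, 1) (baseDeg e i)]
        rcases chi_eq_one_or (k := k) (baseDeg e i) (0, 1) with h2 | h2 <;>
        rcases chi_eq_one_or (k := k) (baseDeg e i) (baseDeg e j) with h3 | h3 <;>
        rcases chi_eq_one_or (k := k) (0, 1) (baseDeg e j) with h4 | h4 <;>
        simp only [h2, h3, h4, chi_weight_self] <;> module

theorem contract_comm [CharZero k] {D D' : ℤ × ℤ} {x y : Polyvector e k}
    (hx : x ∈ homog k (polyDeg e) D) (hy : y ∈ homog k (polyDeg e) D') (β : MixedForm e k) :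
    contract e k x (contract e k y β) = chi k D D' • contract e k y (contract e k x β) := by
  simp only [← Module.End.mul_apply, ← contract_mul, mul_comm' hx hy, map_smul,
    LinearMap.smul_apply]

variable (e k) in
/-- The summand `d̃u_i ∂/∂u_i` of the differential. -/
def mixedDSummand (i : Fin l) : Module.End k (MixedForm e k) :=
  mul k (mixedDeg e) (gen k (mixedDeg e) (sndG i)) ∘ₗ leftDeriv k (mixedDeg e) (fstG i)

theorem mixedD_eq_sum : mixedD e k = ∑ i, mixedDSummand e k i := rfl

-- The summand composes two operators that act as first order derivations on contractions. In the
-- double commutator the terms with both derivatives on one polyvector, or with none on `a` or none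
-- on `b`, cancel. What survives has one derivative on `a` and one on `b`: the `i`-th term of the
-- bracket.
set_option maxHeartbeats 4000000 in
theorem mixedDSummand_commutator [CharZero k] (i : Fin l) {A B : ℤ × ℤ} {a b : Polyvector e k}
    (ha : a ∈ homog k (polyDeg e) A) (hb : b ∈ homog k (polyDeg e) B) (β : MixedForm e k) :
    mixedDSummand e k i (contract e k a (contract e k b β))
      - chi k (0, 1) A • contract e k a (mixedDSummand e k i (contract e k b β))
      - chi k (A + (0, 1)) B • contract e k b (mixedDSummand e k i (contract e k a β)
        - chi k (0, 1) A • contract e k a (mixedDSummand e k i β)) =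
    -chi k (0, 1) A • contract e k (conjScalar e k i • mul k (polyDeg e)
        (rightDeriv k (polyDeg e) (vG e i) a) (leftDeriv k (polyDeg e) (uG e i) b) -
      (chi k (0, 1) (baseDeg e i) * conjScalar e k i) • mul k (polyDeg e)
        (rightDeriv k (polyDeg e) (uG e i) a) (leftDeriv k (polyDeg e) (vG e i) b)) β := by
  have hXa := leftDeriv_mem_homog (uG e i) a ha
  have hVa := leftDeriv_mem_homog (vG e i) a ha
  have hXb := leftDeriv_mem_homog (uG e i) b hb
  have hVXa := leftDeriv_mem_homog (vG e i) _ hXa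
  simp only [mixedDSummand, LinearMap.comp_apply]
  rw [rightDeriv_eq _ a ha, rightDeriv_eq _ a ha]
  simp only [leftDeriv_contract i ha, leftDeriv_contract i hb, genMul_contract i ha,
    genMul_contract i hb, genMul_contract i hXa, genMul_contract i hXb,
    map_add, map_smul, map_sub, LinearMap.smul_apply, LinearMap.sub_apply,
    contract_mul, Module.End.mul_apply, contract_comm hb ha, contract_comm hb hXa,
    contract_comm hb hVa, contract_comm hb hVXa]
  -- All contractions now stand in a common order, so only signs remain; they depend on six
  -- independent values `±1`.
  simp only [polyDeg_uG, polyDeg_vG, chi_add_left, chi_sub_left, chi_neg_left,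
    chi_sub_right, chi_neg_right, chi_baseDeg_self, chi_weight_self,
    chi_comm (k := k) (baseDeg e i) (0, 1), chi_comm (k := k) B]
  rcases chi_eq_one_or (k := k) (baseDeg e i) A with h1 | h1 <;>
  rcases chi_eq_one_or (k := k) (baseDeg e i) B with h2 | h2 <;>
  rcases chi_eq_one_or (k := k) (0, 1) A with h3 | h3 <;>
  rcases chi_eq_one_or (k := k) (0, 1) B with h4 | h4 <;>
  rcases chi_eq_one_or (k := k) A B with h5 | h5 <;>
  rcases chi_eq_one_or (k := k) (0, 1) (baseDeg e i) with h6 | h6 <;>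
  simp only [h1, h2, h3, h4, h5, h6] <;> module

end Commutators

/-! ### The derived bracket, the divergence and Poisson cohomology -/

section Boundary

variable {l : ℕ} {e : Fin l → ℤ × ℤ} {k : Type*} [Field k]

/-- The bracket is the derived bracket of the differential. -/
theorem mixedD_commutator [CharZero k] {A B : ℤ × ℤ} {a b : Polyvector e k}
    (ha : a ∈ homog k (polyDeg e) A) (hb : b ∈ homog k (polyDeg e) B) (β : MixedForm e k) :
    mixedD e k (contract e k a (contract e k b β))
      - chi k (0, 1) A • contract e k a (mixedD e k (contract e k b β))
      - chi k (A + (0, 1)) B • contract e k b (mixedD e k (contract e k a β)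
        - chi k (0, 1) A • contract e k a (mixedD e k β)) =
    -chi k (0, 1) A • contract e k (schouten e k a b) β := by
  rw [schouten_eq, map_sum, LinearMap.sum_apply, Finset.smul_sum]
  rw [← Finset.sum_congr rfl fun i _ => mixedDSummand_commutator i ha hb β]
  simp only [mixedD_eq_sum, LinearMap.sum_apply, map_sum, Finset.sum_sub_distrib, Finset.smul_sum,
    map_sub, map_smul, smul_sub]

theorem mixedD_mem {D : ℤ × ℤ} {β : MixedForm e k} (hβ : β ∈ homog k (mixedDeg e) D) :
    mixedD e k β ∈ homog k (mixedDeg e) (D + (0, 1)) := by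
  rw [mixedD_apply]
  refine Submodule.sum_mem _ fun i _ => ?_
  have := mul_mem_homog (gen_mem_homog (k := k) (d := mixedDeg e) (sndG i))
    (leftDeriv_mem_homog (fstG i) β hβ)
  rw [mixedDeg_fstG, mixedDeg_sndG] at this
  convert this using 2
  abel

/-- In the double sum, exchanging `i` and `j` changes the sign of each term, through the additional
weight carried by `d̃u_i` and `d̃u_j`. The sum therefore equals its negative. -/
theorem mixedD_mixedD [CharZero k] (β : MixedForm e k) : mixedD e k (mixedD e k β) = 0 := by
  set Y := fun i => mul k (mixedDeg e) (gen k (mixedDeg e) (sndG i)) with hY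
  set X := fun i => leftDeriv k (mixedDeg e) (fstG i) with hX
  have h1 (i j : Fin l) : X i (Y j (X j β)) =
      (chi k (baseDeg e i) (baseDeg e j) * chi k (0, 1) (baseDeg e i)) • Y j (X i (X j β)) := by
    simp only [hX, hY]
    rw [leftDeriv_gen_mul, if_neg (fstG_ne_sndG i j), zero_add, mixedDeg_fstG, mixedDeg_sndG,
      chi_add_right, chi_comm (k := k) (0, 1)]
  have h2 : mixedD e k (mixedD e k β) = ∑ i, ∑ j,
      (chi k (baseDeg e i) (baseDeg e j) * chi k (0, 1) (baseDeg e i)) •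
        Y i (Y j (X i (X j β))) := by
    rw [mixedD_apply]
    refine Finset.sum_congr rfl fun i _ => ?_
    change Y i (X i (mixedD e k β)) = _
    rw [mixedD_apply, map_sum, map_sum]
    refine Finset.sum_congr rfl fun j _ => ?_
    change Y i (X i (Y j (X j β))) = _
    rw [h1, map_smul]
  have h3 (i j : Fin l) :
      (chi k (baseDeg e i) (baseDeg e j) * chi k (0, 1) (baseDeg e i)) •
        Y i (Y j (X i (X j β))) =
      -((chi k (baseDeg e j) (baseDeg e i) * chi k (0, 1) (baseDeg e j)) •
        Y j (Y i (X j (X i β)))) := by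
    simp only [hX, hY]
    rw [gen_gen_mul, leftDeriv_leftDeriv (fstG i)]
    simp only [mixedDeg_sndG, mixedDeg_fstG, map_smul, chi_add_left, chi_add_right, chi_weight_self,
      chi_comm (k := k) (baseDeg e j) (baseDeg e i), chi_comm (k := k) (baseDeg e i) (0, 1)]
    rcases chi_eq_one_or (k := k) (baseDeg e i) (baseDeg e j) with h4 | h4 <;>
    rcases chi_eq_one_or (k := k) (0, 1) (baseDeg e i) with h5 | h5 <;>
    simp only [h4, h5] <;> module
  have h4 : mixedD e k (mixedD e k β) = -mixedD e k (mixedD e k β) := by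
    conv_lhs => rw [h2, Finset.sum_comm]
    rw [h2, ← Finset.sum_neg_distrib]
    refine Finset.sum_congr rfl fun i _ => ?_
    rw [← Finset.sum_neg_distrib]
    exact Finset.sum_congr rfl fun j _ => h3 j i
  have h5 : (2 : k) • mixedD e k (mixedD e k β) = 0 := by
    linear_combination (norm := module) h4
  exact (smul_eq_zero.1 h5).resolve_left two_ne_zero

theorem contractGen_mem (g : Fin (l + l)) {D : ℤ × ℤ} {β : MixedForm e k}
    (hβ : β ∈ homog k (mixedDeg e) D) :
    contractGen e k g β ∈ homog k (mixedDeg e) (polyDeg e g + D) := by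
  rcases eq_uG_or_eq_vG e g with ⟨i, rfl⟩ | ⟨i, rfl⟩
  · rw [contractGen_uG, polyDeg_uG, ← mixedDeg_fstG]
    exact mul_mem_homog (gen_mem_homog _) hβ
  · rw [contractGen_vG, polyDeg_vG, LinearMap.smul_apply]
    refine Submodule.smul_mem _ _ ?_
    have := leftDeriv_mem_homog (sndG i) β hβ
    rw [mixedDeg_sndG] at this
    convert this using 2
    abel

theorem contract_mem [CharZero k] {D' : ℤ × ℤ} {β : MixedForm e k}
    (hβ : β ∈ homog k (mixedDeg e) D') : ∀ D, ∀ x ∈ homog k (polyDeg e) D,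
      contract e k x β ∈ homog k (mixedDeg e) (D + D') := by
  refine homog_induction ?_ (fun p D x hx ih => ?_)
    (fun D x x' h h' => by rw [map_add]; exact add_mem h h')
    (fun D c x h => by rw [map_smul]; exact Submodule.smul_mem _ _ h) (by simp)
  · rwa [contract_one, zero_add]
  · rw [contract_gen_mul, Module.End.mul_apply, add_assoc]
    exact contractGen_mem p ih

/-- A homogeneous injective linear map detects degrees. -/
theorem mem_homog_of_apply_mem {N N' : ℕ} {d : Fin N → ℤ × ℤ} {d' : Fin N' → ℤ × ℤ}
    {f : BiSym k d →ₗ[k] BiSym k d'} (hf : Function.Injective f) {E : ℤ × ℤ}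
    (h : ∀ D, ∀ x ∈ homog k d D, f x ∈ homog k d' (D + E)) {D : ℤ × ℤ} {x : BiSym k d}
    (hx : f x ∈ homog k d' (D + E)) : x ∈ homog k d D := by
  classical
  let _ := (isInternal_homog (k := k) (d := d)).chooseDecomposition
  let _ := (isInternal_homog (k := k) (d := d')).chooseDecomposition
  have hcomm (y) : homogProj (homog k d') (D + E) (f y) = f (homogProj (homog k d) D y) := by
    induction y using DirectSum.Decomposition.inductionOn (homog k d) with
    | zero => simp
    | add x y hx hy => simp only [map_add, hx, hy]
    | @homogeneous j x =>
      by_cases hj : j = D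
      · subst hj
        rw [homogProj_of_mem _ x.2, homogProj_of_mem _ (h _ _ x.2)]
      · rw [homogProj_of_mem_ne _ x.2 hj,
          homogProj_of_mem_ne _ (h _ _ x.2) fun e => hj (add_right_cancel e), map_zero]
  have e1 := hcomm x
  rw [homogProj_of_mem _ hx] at e1
  rw [hf e1]
  exact homogProj_mem _ _ _

/-- The second argument enters only through left derivatives, which satisfy the graded Leibniz rule;
the sign comes from moving `b` past a right derivative of `a`. -/
theorem schouten_mul {A B : ℤ × ℤ} {a b : Polyvector e k} (c : Polyvector e k)
    (ha : a ∈ homog k (polyDeg e) A) (hb : b ∈ homog k (polyDeg e) B) :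
    schouten e k a (mul k (polyDeg e) b c) = mul k (polyDeg e) (schouten e k a b) c +
      chi k (A + (0, 1)) B • mul k (polyDeg e) b (schouten e k a c) := by
  simp only [schouten_eq, map_sum, LinearMap.sum_apply, Finset.smul_sum, ← Finset.sum_add_distrib]
  refine Finset.sum_congr rfl fun i _ => ?_
  have e1 : mul k (polyDeg e) b (mul k (polyDeg e) (rightDeriv k (polyDeg e) (uG e i) a)
      (leftDeriv k (polyDeg e) (vG e i) c)) = chi k B (A - baseDeg e i) •
      mul k (polyDeg e) (rightDeriv k (polyDeg e) (uG e i) a)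
      (mul k (polyDeg e) b (leftDeriv k (polyDeg e) (vG e i) c)) := by
    rw [← mul_assoc', mul_comm' hb (rightDeriv_mem_homog (uG e i) a ha), map_smul,
      LinearMap.smul_apply, mul_assoc', polyDeg_uG]
  have e2 : mul k (polyDeg e) b (mul k (polyDeg e) (rightDeriv k (polyDeg e) (vG e i) a)
      (leftDeriv k (polyDeg e) (uG e i) c)) = chi k B (A - (-baseDeg e i - (0, 1))) •
      mul k (polyDeg e) (rightDeriv k (polyDeg e) (vG e i) a)
      (mul k (polyDeg e) b (leftDeriv k (polyDeg e) (uG e i) c)) := by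
    rw [← mul_assoc', mul_comm' hb (rightDeriv_mem_homog (vG e i) a ha), map_smul,
      LinearMap.smul_apply, mul_assoc', polyDeg_vG]
  simp only [leftDeriv_mul _ _ _ _ hb, map_add, map_sub, map_smul, LinearMap.sub_apply,
    LinearMap.smul_apply, mul_assoc', e1, e2, polyDeg_uG, polyDeg_vG]
  simp only [chi_add_left, chi_sub_left, chi_neg_left, chi_comm (k := k) B]
  rcases chi_eq_one_or (k := k) (baseDeg e i) B with h1 | h1 <;>
  rcases chi_eq_one_or (k := k) A B with h2 | h2 <;>
  rcases chi_eq_one_or (k := k) (0, 1) B with h3 | h3 <;>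
  simp only [h1, h2, h3] <;> module

/-! ### The Batalin–Vilkovisky operator of a closed mixed volume form -/

variable {γ : MixedForm e k} (hγ : Function.Bijective fun P : Polyvector e k => contract e k P γ)

/-- The isomorphism from polyvectors to mixed forms given by a mixed volume form. -/
def volumeEquiv : Polyvector e k ≃ₗ[k] MixedForm e k :=
  LinearEquiv.ofBijective ((contract e k).flip γ) hγ

theorem volumeEquiv_apply (P : Polyvector e k) : volumeEquiv hγ P = contract e k P γ := rfl

/-- The divergence operator of a mixed volume form. -/
def divergence : Polyvector e k →ₗ[k] Polyvector e k :=
  -((volumeEquiv hγ).symm.toLinearMap ∘ₗ mixedD e k ∘ₗ (volumeEquiv hγ).toLinearMap)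

/-- The relation characterizing the divergence, used in place of its definition. The minus sign
matches the normalization in which `Δ` generates the bracket. -/
theorem contract_divergence (P : Polyvector e k) :
    contract e k (divergence hγ P) γ = -mixedD e k (contract e k P γ) := by
  rw [← volumeEquiv_apply hγ, ← volumeEquiv_apply hγ]
  simp [divergence]

include hγ in
theorem eq_of_contract_eq {P Q : Polyvector e k} (h : contract e k P γ = contract e k Q γ) :
    P = Q := hγ.1 h

theorem divergence_divergence [CharZero k] (P : Polyvector e k) :
    divergence hγ (divergence hγ P) = 0 := by
  apply eq_of_contract_eq hγ
  rw [contract_divergence, contract_divergence, map_neg, mixedD_mixedD]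
  simp

/-- Contraction into `γ` shifts every bidegree by that of `γ`, and its inverse shifts back, so only
the bidegree `(0,1)` of `d̃` remains. -/
theorem divergence_mem [CharZero k] {E : ℤ × ℤ} (hE : γ ∈ homog k (mixedDeg e) E) {D : ℤ × ℤ}
    {P : Polyvector e k} (hP : P ∈ homog k (polyDeg e) D) :
    divergence hγ P ∈ homog k (polyDeg e) (D + (0, 1)) := by
  refine mem_homog_of_apply_mem (f := (contract e k).flip γ) hγ.1 (contract_mem hE) ?_
  rw [LinearMap.flip_apply, contract_divergence, add_right_comm]
  exact neg_mem (mixedD_mem (contract_mem hE _ _ hP))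

/-- The divergence operator of a closed mixed volume form generates the bracket. -/
theorem schouten_eq_divergence [CharZero k] (hd : mixedD e k γ = 0) {E : ℤ × ℤ}
    (hE : γ ∈ homog k (mixedDeg e) E) {D : ℤ × ℤ} {P : Polyvector e k}
    (hP : P ∈ homog k (polyDeg e) D) (Q : Polyvector e k) :
    schouten e k P Q = chi k (0, 1) D • divergence hγ (mul k (polyDeg e) P Q) -
      chi k (0, 1) D • mul k (polyDeg e) (divergence hγ P) Q -
      mul k (polyDeg e) P (divergence hγ Q) := by
  induction Q using mon_induction with
  | add x y hx hy => simp only [map_add, hx, hy]; module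
  | smul c x hx => simp only [map_smul, hx]; module
  | mon b _ =>
  have hQ := mon_mem (k := k) (d := polyDeg e) b
  generalize mon k (polyDeg e) b = Q at hQ
  generalize expDeg (polyDeg e) b = B at hQ
  apply eq_of_contract_eq hγ
  have key := mixedD_commutator hP hQ γ
  -- Writing `Δ(P) Q` as `± Q Δ(P)` turns its contraction into `ι̃_Q d̃ ι̃_P γ` up to sign, as in
  -- the double commutator.
  rw [mul_comm' (divergence_mem hγ hE hP) hQ]
  simp only [map_sub, map_smul, LinearMap.sub_apply, LinearMap.smul_apply, contract_divergence,
    contract_mul, Module.End.mul_apply, map_neg]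
  -- Closedness of `γ` removes the fourth term of the double commutator, leaving the three terms of
  -- the generating formula.
  simp only [hd, map_zero, smul_zero, sub_zero] at key
  rcases chi_eq_one_or (k := k) (0, 1) D with h1 | h1 <;> simp only [h1] at key ⊢
  · linear_combination (norm := module) key
  · linear_combination (norm := module) -key

/-- Polyvectors are generated, as a Batalin–Vilkovisky algebra, by the divergence. -/
theorem isBVGenerator_divergence [CharZero k] (hd : mixedD e k γ = 0) {E : ℤ × ℤ}
    (hE : γ ∈ homog k (mixedDeg e) E) :
    IsBVGenerator (fun s t => homog k (polyDeg e) (-s, -t)) (one k (polyDeg e))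
      (mul k (polyDeg e)) (schouten e k) (divergence hγ) where
  isInternal := by
    -- The piece with index `(s,t)` has bidegree `(-s,-t)`, so the decomposition by bidegree is
    -- reindexed along negation.
    have h := isInternal_homog (k := k) (d := polyDeg e)
    rw [DirectSum.isInternal_submodule_iff_iSupIndep_and_iSup_eq_top] at h ⊢
    exact ⟨h.1.comp (Equiv.neg (ℤ × ℤ)).injective,
      ((Equiv.neg (ℤ × ℤ)).iSup_comp (g := homog k (polyDeg e))).trans h.2⟩
  one_mem := one_mem_homog
  mul_mem {s t s' t' a b} ha hb := by
    convert mul_mem_homog ha hb using 2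
    simp only [Prod.mk_add_mk]
    congr 1 <;> ring
  one_mul := one_mul'
  mul_assoc := mul_assoc'
  mul_comm {s t s' t' a b} ha hb := by
    rw [mul_comm' ha hb, chi, dot]
    congr 2
    ring
  br_mul {s t s' t' a b} c ha hb := by
    rw [schouten_mul c ha hb, chi, dot]
    congr 3
    simp only [Prod.mk_add_mk]
    ring
  delta_mem {s t a} ha := by
    convert divergence_mem hγ hE ha using 2
    simp only [Prod.mk_add_mk]
    congr 1 <;> ring
  delta_sq := divergence_divergence hγ
  br_eq {s t a} b ha := by
    have : chi k (0, 1) (-s, -t) = sgn k t := by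
      rw [chi, dot, ← sgn_neg k t]
      congr 1
      ring
    rw [schouten_eq_divergence hγ hd hE ha, this]

/-- A Poisson structure preserving a closed mixed volume form makes the Poisson cohomology a
Batalin–Vilkovisky algebra. -/
theorem hpIsBV_of_isUnimodular [CharZero k] {E : ℤ × ℤ} {π : Polyvector e k}
    (hπ : π ∈ homog k (polyDeg e) (0, -2)) (hππ : schouten e k π π = 0)
    (hE : homog k (mixedDeg e) (E + (0, 1)) = ⊥) (hu : IsUnimodular e E π) : HPIsBV e π := by
  obtain ⟨γ, ⟨hγE, hγ⟩, hγπ⟩ := hu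
  have hd : mixedD e k γ = 0 := by
    have := mixedD_mem hγE
    rwa [hE, Submodule.mem_bot] at this
  have hdiv : divergence hγ π = 0 := by
    apply eq_of_contract_eq hγ
    -- With `d̃γ = 0`, the cycle condition `∂_π γ = 0` becomes `-d̃ ι̃_π γ = 0`, and the left side
    -- is the contraction of `Δ π` into `γ`.
    rw [mixedBoundary, LinearMap.sub_apply, LinearMap.comp_apply, LinearMap.comp_apply, hd,
      map_zero, zero_sub] at hγπ
    rw [contract_divergence, hγπ, map_zero, LinearMap.zero_apply]
  exact (isBVGenerator_divergence hγ hd hγE).isBVAlgebra.cohomology (by simpa using hπ) hππ hdiv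

end Boundary

/-! ### The two bigraded spaces -/

section Spaces

variable (k : Type*) [Field k] (m n : ℕ)

/-- Here `u = x` and `u = ∂_y`; on the dual space `u = ∂_ξ` and `u = η`. The bidegrees coincide, so
one vanishing argument serves both spaces. -/
theorem baseDeg_degA : baseDeg (degA m n) = Fin.append (fun _ => (0, 0)) fun _ => (-1, -1) := by
  funext i
  induction i using Fin.addCases with
  | left i => simp [baseDeg, degA, IsEvenCoord]
  | right i => simp [baseDeg, degA, IsEvenCoord]

theorem baseDeg_degDual :
    baseDeg (degDual m n) = Fin.append (fun _ => (0, 0)) fun _ => (-1, -1) := by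
  funext i
  induction i using Fin.addCases with
  | left i => simp [baseDeg, degDual, IsEvenCoord]; rfl
  | right i => simp [baseDeg, degDual, IsEvenCoord]

/-- There are no mixed forms of bidegree `(-n, m + 1)`. -/
theorem homog_mixedDeg_eq_bot {e : Fin (m + n) → ℤ × ℤ}
    (he : baseDeg e = Fin.append (fun _ => (0, 0)) fun _ => (-1, -1)) :
    homog k (mixedDeg e) ((-(n : ℤ), (m : ℤ)) + (0, 1)) = ⊥ := by
  rw [homog_eq_span, Submodule.span_eq_bot]
  rintro _ ⟨a, ha, hD, rfl⟩
  exfalso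
  have h2 := congrArg Prod.snd hD
  have h3 : (expDeg (mixedDeg e) a).2 ≤ m := by
    -- The generators split into four blocks: the `u_i` have weights `0` (first `m`) and `-1` (last
    -- `n`), and the `d̃u_i` have weights `1` and `0`.
    rw [expDeg, Fin.sum_univ_add, Fin.sum_univ_add, Fin.sum_univ_add]
    have e1 (i : Fin (m + n)) : mixedDeg e (Fin.castAdd _ i) = baseDeg e i := mixedDeg_fstG e i
    have e2 (i : Fin (m + n)) : mixedDeg e (Fin.natAdd _ i) = baseDeg e i + (0, 1) :=
      mixedDeg_sndG e i
    simp only [e1, e2, he, Fin.append_left, Fin.append_right]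
    simp only [Prod.snd_add, Prod.snd_sum, Prod.smul_mk, Prod.mk_add_mk, smul_zero,
      Finset.sum_const_zero, zero_add, neg_add_cancel, smul_neg, nsmul_eq_mul, mul_one, add_zero]
    -- The only generators of positive weight have bidegree `(0,1)`, so they square to zero and
    -- together contribute at most `m`.
    have h4 : ∑ x : Fin m, (a (Fin.natAdd (m + n) (Fin.castAdd n x)) : ℤ) ≤ ∑ x : Fin m, 1 := by
      refine Finset.sum_le_sum fun i _ => ?_
      have : Odd (dot (mixedDeg e (Fin.natAdd (m + n) (Fin.castAdd n i)))
          (mixedDeg e (Fin.natAdd (m + n) (Fin.castAdd n i)))) := by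
        rw [e2, he, Fin.append_left]
        simp [dot]
      exact_mod_cast ha _ this
    have h5 : ∑ x : Fin n, -(a (Fin.castAdd (m + n) (Fin.natAdd m x)) : ℤ) ≤ 0 :=
      Finset.sum_nonpos fun i _ => by simp
    simp only [Finset.sum_const, Finset.card_univ, Fintype.card_fin, nsmul_eq_mul, mul_one] at h4
    linarith
  rw [h2] at h3
  simp at h3

end Spaces

end BigradedPoisson

end

open BigradedPoisson in
theorem mainTheorem9 (k : Type*) [Field k] [CharZero k] (m n : ℕ)
    (π : Polyvector (degA m n) k) (πdual : Polyvector (degDual m n) k)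
    (hπ : IsQuadraticPoisson (degA m n) π)
    (hπdual : IsQuadraticPoisson (degDual m n) πdual)
    (hu : IsUnimodular (degA m n) (-(n : ℤ), (m : ℤ)) π)
    (hudual : IsUnimodular (degDual m n) (-(n : ℤ), (m : ℤ)) πdual) :
    HPIsBV (degA m n) π ∧ HPIsBV (degDual m n) πdual :=
  ⟨hpIsBV_of_isUnimodular hπ.bidegree hπ.poisson
      (homog_mixedDeg_eq_bot k m n (baseDeg_degA m n)) hu,
    hpIsBV_of_isUnimodular hπdual.bidegree hπdual.poisson
      (homog_mixedDeg_eq_bot k m n (baseDeg_degDual m n)) hudual⟩
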